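/- Throughout, $\log x$ stands for $\max\{\ln x,1\}$ (in particular for $x=0$ it stands for $1$). Let $\mathcal Y$ be a finite label set with $|\mathcal Y|=k$, let $\mathcal X$ be an instance space, and let $\mathcal C$ be a class of $\ell$-list predictors, that is, of functions $c$ that assign to every $x\in\mathcal X$ a set $c(x)\subseteq\mathcal Y$ of exactly $\ell$ labels. A nonempty set $B\subseteq\mathcal Y^{T}$ is an $(\ell+1)$-pseudo-cube if for every $v\in B$ and every $i\in T$ there are $\ell$ distinct vectors in $B$ that differ from $v$ at $i$ and agree with $v$ on all other coordinates. A finite set $T\subseteq\mathcal X$ is $\ell$-DS-shattered by $\mathcal C$ if $\{(y_x)_{x\in T}:\exists c\in\mathcal C\ \forall x\in T,\ y_x\in c(x)\}$ contains a finite $(\ell+1)$-pseudo-cube, and $\mathrm{DS}_\ell(\mathcal C)$ is the maximum size of an $\ell$-DS-shattered set. For a probability distribution $\mathcal D$ on $\mathcal X\times\mathcal Y$ let $\mathcal L_{\mathcal D}(c)=\Pr_{(x,y)\sim\mathcal D}[y\notin c(x)]$, and for a sample $S=((x_i,y_i))_{i=1}^n$ let $\mathcal L_S(c)=\frac1n\sum_{i=1}^n\mathbf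 1\{y_i\notin c(x_i)\}$. The class $\mathcal C$ satisfies uniform convergence if for all $\varepsilon,\delta\in(0,1)$ there is an integer $m\ge 1$ such that for every distribution $\mathcal D$ on $\mathcal X\times\mathcal Y$, with probability at least $1-\delta$ over $m$ i.i.d. samples $S$ from $\mathcal D$, $\sup_{c\in\mathcal C}|\mathcal L_{\mathcal D}(c)-\mathcal L_S(c)|\le\varepsilon$; the least such $m$ is denoted $m^{\mathrm{UC}}_{\mathcal C}(\varepsilon,\delta)$. Here $\mathcal D$ ranges over the distributions under which $\mathcal C$ is measurable in the usual sense: up to null sets, the events $\{y\notin c(x)\}$, $c\in\mathcal C$, and the suprema $\sup_{c\in\mathcal C}|\sum_{i=1}^n e_i\mathbf 1\{y_i\notin c(x_i)\}|$, $n\in\mathbb N$, $e\in\mathbb R^n$, are measurable (this is automatic, for instance, when $\mathcal X$ is countable and discrete). Theorem. There is a universal constant $A>0$ such that every such class $\mathcal C$ with $d=\mathrm{DS}_\ell(\mathcal C)<\infty$ satisfies uniform convergence with sample complexity $$m^{\mathrm{UC}}_{\mathcal C}(\varepsilon,\delta)\ \le\ A\,\frac{\ell d\log(\ell d k)+\log(1/\delta)}{\varepsilon^2}\qquad\text{for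 all }\varepsilon,\delta\in(0,1).$$ In particular, $m^{\mathrm{UC}}_{\mathcal C}(\varepsilon,\delta)=\widetilde O\big((\ell d+\log(1/\delta))/\varepsilon^2\big)$, where $\widetilde O$ hides polylogarithmic factors in $d,\ell,k$. -/

import Mathlib

open MeasureTheory

noncomputable section

namespace ListUC

variable {X Y : Type*}

/-- A nonempty set `B` of vectors is an `m`-pseudo-cube if for every `v ∈ B` and every coordinate
`i` there are `m - 1` distinct vectors in `B` that differ from `v` in the coordinate `i` and agree
with `v` on all the other coordinates. -/
def IsPseudoCube {ι : Type*} (m : ℕ) (B : Set (ι → Y)) : Prop :=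
  B.Nonempty ∧ ∀ v ∈ B, ∀ i : ι, ∃ N : Finset (ι → Y), N.card = m - 1 ∧
    ∀ u ∈ N, u ∈ B ∧ u i ≠ v i ∧ ∀ j, j ≠ i → u j = v j

/-- The patterns that a class of list predictors induces on a set `T` of points. -/
def patterns (C : Set (X → Finset Y)) (T : Finset X) : Set (T → Y) :=
  {y | ∃ c ∈ C, ∀ j : T, y j ∈ c j}

/-- `T` is `ℓ`-DS-shattered by `C`: the patterns on `T` contain a finite `(ℓ+1)`-pseudo-cube. -/
def DSShatters (ℓ : ℕ) (C : Set (X → Finset Y)) (T : Finset X) : Prop :=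
  ∃ B : Set (T → Y), B.Finite ∧ IsPseudoCube (ℓ + 1) B ∧ B ⊆ patterns C T

/-- The `ℓ`-DS dimension: the maximum size of an `ℓ`-DS-shattered set (`⊤` if unbounded). -/
def dsDim (ℓ : ℕ) (C : Set (X → Finset Y)) : ℕ∞ :=
  ⨆ (T : Finset X) (_ : DSShatters ℓ C T), (T.card : ℕ∞)

/-- The zero-one list loss: `1` if `y ∉ c x` and `0` otherwise. -/
def loss (c : X → Finset Y) (z : X × Y) : ℝ :=
  Set.indicator {w : X × Y | w.2 ∉ c w.1} (fun _ => 1) z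

/-- The empirical loss of `c` on a sample of size `n`. -/
def empLoss (c : X → Finset Y) {n : ℕ} (S : Fin n → X × Y) : ℝ :=
  (1 / (n : ℝ)) * ∑ i, loss c (S i)

/-- The logarithm with the convention `log x := max (log x) 1`. -/
def plog (x : ℝ) : ℝ := max (Real.log x) 1

variable [MeasurableSpace X] [MeasurableSpace Y]

/-- The population loss of `c`: the probability that `y ∉ c x`. -/
def popLoss (D : Measure (X × Y)) (c : X → Finset Y) : ℝ :=
  D.real {z | z.2 ∉ c z.1}

/-- The usual measurability requirement of empirical process theory on a class under `D`: each error
event is measurable, and so is each supremum `sup_c |∑ i, e i * loss c (z i)|` of a linear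
combination of losses (both up to null sets). It holds for instance if `X` is countable and
discrete, or if `C` is countable with measurable error events. For uncountable classes uniform
convergence can fail without such a requirement even at dimension one. -/
structure IsMeasurableClass (C : Set (X → Finset Y)) (D : Measure (X × Y)) : Prop where
  error : ∀ c ∈ C, NullMeasurableSet {z : X × Y | z.2 ∉ c z.1} D
  sup : ∀ (n : ℕ) (e : Fin n → ℝ),
    AEMeasurable (fun S : Fin n → X × Y => ⨆ c : C, |∑ i, e i * loss c.1 (S i)|)
      (Measure.pi fun _ : Fin n => D)

/-- For every distribution `D`, with probability at least `1 - δ` over `n` i.i.d. samples, every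
`c ∈ C` has `|popLoss - empLoss| ≤ ε`; that is, the (outer) probability of the complementary event
is at most `δ`. -/
def UniformAt (C : Set (X → Finset Y)) (ε δ : ℝ) (n : ℕ) : Prop :=
  ∀ D : Measure (X × Y), IsProbabilityMeasure D → IsMeasurableClass C D →
    (Measure.pi fun _ : Fin n => D)
      {S | ∃ c ∈ C, ε < |popLoss D c - empLoss c S|} ≤ ENNReal.ofReal δ

/-- `C` satisfies uniform convergence. -/
def SatisfiesUC (C : Set (X → Finset Y)) : Prop :=
  ∃ m : ℝ → ℝ → ℕ, ∀ ε ∈ Set.Ioo (0 : ℝ) 1, ∀ δ ∈ Set.Ioo (0 : ℝ) 1,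
    0 < m ε δ ∧ UniformAt C ε δ (m ε δ)

/-- The uniform convergence sample complexity: the least (positive) sample size that works. It is
meaningful for classes that satisfy uniform convergence. -/
def ucSampleComplexity (C : Set (X → Finset Y)) (ε δ : ℝ) : ℕ :=
  sInf {n : ℕ | 0 < n ∧ UniformAt C ε δ n}

end ListUC

end

noncomputable section

namespace ListUC

variable {X Y : Type*}

open Finset in
/-- A nonzero function on `Y` whose moments of order `< ℓ` vanish has at least `ℓ + 1` points in its
support. -/
theorem lt_card_support_of_moments_eq_zero [Fintype Y] [DecidableEq Y] {e : Y → ℝ}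
    (he : Function.Injective e) {f : Y → ℝ} {ℓ : ℕ}
    (h : ∀ a < ℓ, ∑ t, f t * e t ^ a = 0) {t₀ : Y} (ht₀ : f t₀ ≠ 0) :
    ℓ < (univ.filter fun t => f t ≠ 0).card := by
  by_contra! hcard
  set s := univ.filter fun t => f t ≠ 0 with hs
  have hmem : t₀ ∈ s := by simp [hs, ht₀]
  let P : Polynomial ℝ := ∏ t ∈ s.erase t₀, (Polynomial.X - Polynomial.C (e t))
  have hdeg : P.natDegree < ℓ := by
    have h1 : P.natDegree = (s.erase t₀).card := by
      simp only [P]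
      exact Polynomial.natDegree_finsetProd_X_sub_C_eq_card _ _
    have h2 := card_erase_lt_of_mem hmem
    omega
  have hzero : ∑ t, f t * P.eval (e t) = 0 := by
    simp_rw [Polynomial.eval_eq_sum_range' hdeg, mul_sum]
    rw [sum_comm]
    refine sum_eq_zero fun a ha => ?_
    have := h a (mem_range.1 ha)
    calc ∑ t, f t * (P.coeff a * e t ^ a) = P.coeff a * ∑ t, f t * e t ^ a := by
          rw [mul_sum]; exact sum_congr rfl fun _ _ => by ring
      _ = 0 := by rw [this, mul_zero]
  have hsingle : ∑ t, f t * P.eval (e t) = f t₀ * P.eval (e t₀) := by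
    refine sum_eq_single t₀ (fun t _ hne => ?_) (by simp)
    by_cases hft : f t = 0
    · simp [hft]
    · have : P.eval (e t) = 0 := by
        simp only [P, Polynomial.eval_prod]
        exact prod_eq_zero (mem_erase.2 ⟨hne, by simp [hs, hft]⟩) (by simp)
      simp [this]
  have hne : P.eval (e t₀) ≠ 0 := by
    simp only [P, Polynomial.eval_prod]
    refine prod_ne_zero_iff.2 fun t ht => ?_
    simp only [Polynomial.eval_sub, Polynomial.eval_X, Polynomial.eval_C]
    exact sub_ne_zero.2 fun hh => (mem_erase.1 ht).1 (he hh).symm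
  exact mul_ne_zero ht₀ hne (hsingle ▸ hzero)

/-- The univariate test functions: `inl a` is the monomial `e ^ a` and `inr u` the indicator
of `u`. -/
def testFun [DecidableEq Y] (e : Y → ℝ) {ℓ : ℕ} : Fin ℓ ⊕ Y → Y → ℝ
  | Sum.inl a, t => e t ^ (a : ℕ)
  | Sum.inr u, t => if t = u then 1 else 0

/-- The index families with at most `d` coordinates that are indicators. -/
def sparseIndex (ι Y : Type*) [Fintype ι] [Fintype Y] (ℓ d : ℕ) : Finset (ι → Fin ℓ ⊕ Y) :=
  by classical exact
  Finset.univ.filter fun g => (Finset.univ.filter fun i => (g i).isRight).card ≤ d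

theorem card_sparseIndex_le (ι Y : Type*) [Fintype ι] [Fintype Y] {ℓ : ℕ} (hℓ : 0 < ℓ) (d : ℕ) :
    (sparseIndex ι Y ℓ d).card ≤
      ℓ ^ Fintype.card ι * (1 + Fintype.card ι * Fintype.card Y) ^ d := by
  classical
  induction d with
  | zero =>
    have hsub : sparseIndex ι Y ℓ 0 ⊆
        (Finset.univ : Finset (ι → Fin ℓ)).image fun b i => Sum.inl (b i) := by
      intro g hg
      simp only [sparseIndex, Finset.mem_filter, Finset.mem_univ, true_and, Nat.le_zero,
        Finset.card_eq_zero, Finset.filter_eq_empty_iff, true_imp_iff] at hg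
      have : ∀ i, ∃ a, g i = Sum.inl a := fun i => by
        cases h : g i with
        | inl a => exact ⟨a, rfl⟩
        | inr u => exact absurd (by simp [h]) (@hg i)
      choose b hb using this
      exact Finset.mem_image.2 ⟨b, Finset.mem_univ _, funext fun i => (hb i).symm⟩
    calc _ ≤ _ := Finset.card_le_card hsub
      _ ≤ _ := Finset.card_image_le
      _ = _ := by simp
  | succ d ih =>
    have hsub : sparseIndex ι Y ℓ (d + 1) ⊆
        (sparseIndex ι Y ℓ d ×ˢ (Finset.univ : Finset (Option (ι × Y)))).image fun p =>
          match p.2 with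
          | none => p.1
          | some q => Function.update p.1 q.1 (Sum.inr q.2) := by
      intro g hg
      by_cases hgd : g ∈ sparseIndex ι Y ℓ d
      · exact Finset.mem_image.2 ⟨(g, none), by simp [hgd], rfl⟩
      simp only [sparseIndex, Finset.mem_filter, Finset.mem_univ, true_and, not_le] at hg hgd
      obtain ⟨i, hi⟩ := Finset.card_pos.1 (lt_of_le_of_lt (Nat.zero_le d) hgd)
      obtain ⟨u, hu⟩ := Sum.isRight_iff.1 (Finset.mem_filter.1 hi).2
      refine Finset.mem_image.2 ⟨(Function.update g i (Sum.inl ⟨0, hℓ⟩), some (i, u)), ?_, ?_⟩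
      · simp only [sparseIndex, Finset.mem_product, Finset.mem_filter, Finset.mem_univ, true_and,
          and_true]
        have : (Finset.univ.filter fun j =>
            (Function.update g i (Sum.inl ⟨0, hℓ⟩) j).isRight = true) ⊆
            (Finset.univ.filter fun j => (g j).isRight = true).erase i := by
          intro j hj
          have hj := (Finset.mem_filter.1 hj).2
          by_cases hji : j = i
          · subst hji; simp at hj
          · simpa [hji] using hj
        have h1 := Finset.card_le_card this
        have h2 := Finset.card_erase_lt_of_mem hi
        omega
      · simp [← hu]
    calc _ ≤ _ := Finset.card_le_card hsub
      _ ≤ _ := Finset.card_image_le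
      _ = (sparseIndex ι Y ℓ d).card * (1 + Fintype.card ι * Fintype.card Y) := by
        simp [Finset.card_product, add_comm]
      _ ≤ _ := Nat.mul_le_mul_right _ ih
      _ = _ := by ring

/-- A Sauer-type bound: a set of vectors none of whose projections to more than `d` coordinates
contains an `(ℓ + 1)`-pseudo-cube has at most `ℓ ^ n * (1 + n * k) ^ d` elements. -/
theorem card_le_of_pseudoCube_card_le {ι : Type*} [Fintype ι] [Fintype Y] {ℓ d : ℕ} (hℓ : 0 < ℓ)
    (F : Finset (ι → Y))
    (hF : ∀ (S : Finset ι) (B : Set (S → Y)), IsPseudoCube (ℓ + 1) B →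
      (∀ w ∈ B, ∃ y ∈ F, ∀ i : S, y i = w i) → S.card ≤ d) :
    F.card ≤ ℓ ^ Fintype.card ι * (1 + Fintype.card ι * Fintype.card Y) ^ d := by
  classical
  refine le_trans ?_ (card_sparseIndex_le ι Y hℓ d)
  let e : Y → ℝ := fun t => (Fintype.equivFin Y t : ℕ)
  have he : Function.Injective e := fun a b h => by
    simpa [e, Fin.val_inj] using h
  let Φ : (ι → Fin ℓ ⊕ Y) → (ι → Y) → ℝ := fun g y => ∏ i, testFun e (g i) (y i)
  let M : (F → ℝ) →ₗ[ℝ] (sparseIndex ι Y ℓ d → ℝ) :=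
    { toFun := fun lam g => ∑ y : F, lam y * Φ g.1 y.1
      map_add' := fun a b => by
        funext g; simp [add_mul, Finset.sum_add_distrib]
      map_smul' := fun a b => by
        funext g; simp [mul_assoc, Finset.mul_sum] }
  have hinj : Function.Injective M := by
    rw [injective_iff_map_eq_zero]
    intro lam hlam
    have hsplit : ∀ (g : ι → Fin ℓ ⊕ Y) (i : ι) (r : Fin ℓ ⊕ Y) (y : ι → Y),
        Φ (Function.update g i r) y =
          testFun e r (y i) * ∏ j ∈ Finset.univ.erase i, testFun e (g j) (y j) := by
      intro g i r y
      simp only [Φ]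
      rw [← Finset.mul_prod_erase _ _ (Finset.mem_univ i)]
      simp only [Function.update_self]
      congr 1
      exact Finset.prod_congr rfl fun j hj => by
        rw [Function.update_of_ne (Finset.ne_of_mem_erase hj)]
    have key : ∀ m : ℕ, ∀ g : ι → Fin ℓ ⊕ Y,
        (Finset.univ.filter fun i => (g i).isRight).card = m → ∑ y : F, lam y * Φ g y.1 = 0 := by
      intro m
      induction m using Nat.strong_induction_on with
      | _ m ih =>
      intro g hg
      by_cases hmd : m ≤ d
      · have hmem : g ∈ sparseIndex ι Y ℓ d := by
          simp only [sparseIndex, Finset.mem_filter, Finset.mem_univ, true_and]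
          omega
        exact congrFun hlam ⟨g, hmem⟩
      set S := Finset.univ.filter fun i => (g i).isRight = true with hS
      let G : (S → Y) → ι → Fin ℓ ⊕ Y := fun w i => if h : i ∈ S then Sum.inr (w ⟨i, h⟩) else g i
      let μ : (S → Y) → ℝ := fun w => ∑ y : F, lam y * Φ (G w) y.1
      have hGupd : ∀ w (i : S) t, G (Function.update w i t) =
          Function.update (G w) i.1 (Sum.inr t) := by
        intro w i t
        funext j
        by_cases hji : j = i.1
        · subst hji; simp [G]
        · by_cases hj : j ∈ S
          · have : (⟨j, hj⟩ : S) ≠ i := fun h => hji (by rw [← h])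
            simp [G, hj, hji, this]
          · simp [G, hj, hji]
      have hline : ∀ w (i : S), ∀ a < ℓ, ∑ t, μ (Function.update w i t) * e t ^ a = 0 := by
        intro w i a ha
        have hcard : (Finset.univ.filter fun j =>
            (Function.update (G w) i.1 (Sum.inl ⟨a, ha⟩) j).isRight = true).card < m := by
          have hsub : (Finset.univ.filter fun j =>
              (Function.update (G w) i.1 (Sum.inl ⟨a, ha⟩) j).isRight = true) ⊆ S.erase i.1 := by
            intro j hj
            have hj := (Finset.mem_filter.1 hj).2
            by_cases hji : j = i.1
            · subst hji; simp at hj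
            · rw [Function.update_of_ne hji] at hj
              refine Finset.mem_erase.2 ⟨hji, ?_⟩
              by_contra hjS
              simp only [G, hjS, dite_false] at hj
              exact hjS (by simp [hS, hj])
          have h1 := Finset.card_le_card hsub
          have h2 := Finset.card_erase_lt_of_mem i.2
          omega
        rw [← ih _ hcard _ rfl]
        simp only [μ, Finset.sum_mul]
        rw [Finset.sum_comm]
        refine Finset.sum_congr rfl fun y _ => ?_
        simp_rw [hGupd, hsplit]
        rw [Finset.sum_eq_single (y.1 i.1)]
        · simp only [testFun, if_true]; ring
        · intro t _ ht
          simp [testFun, ht.symm]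
        · simp
      have hμ : ∀ w, μ w = 0 := by
        by_contra! hne
        refine hmd ?_
        rw [← hg]
        refine hF S {w | μ w ≠ 0} ⟨hne, fun w hw i => ?_⟩ fun w hw => ?_
        · have hsupp := lt_card_support_of_moments_eq_zero he
            (f := fun t => μ (Function.update w i t)) (hline w i) (t₀ := w i) (by simpa using hw)
          have hle : ℓ ≤ ((Finset.univ.filter fun t =>
              μ (Function.update w i t) ≠ 0).erase (w i)).card := by
            have := Finset.pred_card_le_card_erase
              (s := Finset.univ.filter fun t => μ (Function.update w i t) ≠ 0) (a := w i)
            omega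
          obtain ⟨N, hN, hNcard⟩ := Finset.exists_subset_card_eq hle
          refine ⟨N.image fun t => Function.update w i t, ?_, ?_⟩
          · rw [Finset.card_image_of_injective _ (Function.update_injective w i), hNcard]
            simp
          · intro u hu
            obtain ⟨t, ht, rfl⟩ := Finset.mem_image.1 hu
            have := hN ht
            simp only [Finset.mem_erase, Finset.mem_filter, Finset.mem_univ, true_and] at this
            refine ⟨this.2, by simpa using this.1, fun j hj => by simp [hj]⟩
        · obtain ⟨y, -, hy⟩ := Finset.exists_ne_zero_of_sum_ne_zero hw
          refine ⟨y.1, y.2, fun i => ?_⟩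
          have h1 := Finset.prod_ne_zero_iff.1 (right_ne_zero_of_mul hy) i.1 (Finset.mem_univ _)
          by_contra h2
          simp [G, testFun, h2] at h1
      have hright : ∀ i : S, ∃ u, g i.1 = Sum.inr u := fun i =>
        Sum.isRight_iff.1 (Finset.mem_filter.1 i.2).2
      choose w hw using hright
      have hGw : G w = g := by
        funext i
        by_cases hi : i ∈ S
        · simp only [G, hi, dite_true]; exact (hw ⟨i, hi⟩).symm
        · simp [G, hi]
      have := hμ w
      simpa only [μ, hGw] using this
    funext y₀
    have h := key _ (fun i => Sum.inr (y₀.1 i)) rfl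
    rw [Finset.sum_eq_single y₀] at h
    · simpa [Φ, testFun] using h
    · intro y _ hy
      obtain ⟨i, hi⟩ := Function.ne_iff.1 fun h => hy (Subtype.ext h)
      have : Φ (fun i => Sum.inr (y₀.1 i)) y.1 = 0 :=
        Finset.prod_eq_zero (Finset.mem_univ i) (by simp [testFun, hi])
      rw [this, mul_zero]
    · simp
  have := LinearMap.finrank_le_finrank_of_injective hinj
  simpa using this

theorem IsPseudoCube.reindex {ι κ : Type*} (f : κ ≃ ι) {m : ℕ} {B : Set (ι → Y)}
    (hB : IsPseudoCube m B) : IsPseudoCube m ((fun w : ι → Y => w ∘ f) '' B) := by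
  classical
  refine ⟨hB.1.image _, ?_⟩
  rintro _ ⟨v, hv, rfl⟩ i
  obtain ⟨N, hN, hN'⟩ := hB.2 v hv (f i)
  refine ⟨N.image fun w => w ∘ f, ?_, fun u hu => ?_⟩
  · rw [Finset.card_image_of_injective _ f.surjective.injective_comp_right, hN]
  · obtain ⟨w, hw, rfl⟩ := Finset.mem_image.1 hu
    obtain ⟨h1, h2, h3⟩ := hN' w hw
    exact ⟨⟨w, h1, rfl⟩, h2, fun j hj => h3 _ (f.injective.ne hj)⟩

theorem card_le_of_dsDim_eq {ℓ d : ℕ} {C : Set (X → Finset Y)} (hd : dsDim ℓ C = (d : ℕ∞))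
    {T : Finset X} (hT : DSShatters ℓ C T) : T.card ≤ d := by
  have : (T.card : ℕ∞) ≤ dsDim ℓ C := le_iSup₂_of_le T hT le_rfl
  rw [hd] at this
  exact_mod_cast this

/-- The number of patterns of a class of `ℓ`-list predictors on a finite set. -/
theorem card_patterns_le [Fintype Y] {ℓ d : ℕ} (hℓ : 0 < ℓ) {C : Set (X → Finset Y)}
    (hd : dsDim ℓ C = (d : ℕ∞)) (T : Finset X) (F : Finset (T → Y)) (hF : ↑F ⊆ patterns C T) :
    F.card ≤ ℓ ^ T.card * (1 + T.card * Fintype.card Y) ^ d := by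
  classical
  have h := card_le_of_pseudoCube_card_le (d := d) hℓ F fun S B hB hBF => by
    let f : S ≃ (S.map (Function.Embedding.subtype _) : Finset X) :=
      Equiv.ofBijective (fun i => ⟨i.1.1, Finset.mem_map_of_mem _ i.2⟩)
        ⟨fun a b h => Subtype.ext (Subtype.ext (Subtype.mk.inj h)), fun ⟨x, hx⟩ => by
          obtain ⟨i, hi, rfl⟩ := Finset.mem_map.1 hx
          exact ⟨⟨i, hi⟩, rfl⟩⟩
    rw [← S.card_map (Function.Embedding.subtype _)]
    refine card_le_of_dsDim_eq hd ⟨(fun w : S → Y => w ∘ f.symm) '' B, Set.toFinite _,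
      hB.reindex f.symm, ?_⟩
    rintro _ ⟨w, hw, rfl⟩
    obtain ⟨y, hy, hyw⟩ := hBF w hw
    obtain ⟨c, hc, hcy⟩ := hF hy
    refine ⟨c, hc, fun j => ?_⟩
    obtain ⟨i, rfl⟩ := f.surjective j
    simp only [Function.comp_apply, Equiv.symm_apply_apply]
    rw [← hyw i]
    exact hcy i.1
  simpa using h

theorem two_rpow_le_one_add {t : ℝ} (h0 : 0 ≤ t) (h1 : t ≤ 1) : (2 : ℝ) ^ t ≤ 1 + t := by
  have := rpow_one_add_le_one_add_mul_self (s := 1) (by norm_num) h0 h1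
  norm_num at this
  linarith

/-- The error sets of the class of list predictors shatter `U`. -/
def PairShatters (C : Set (X → Finset Y)) (U : Finset (X × Y)) : Prop :=
  ∀ b ⊆ U, ∃ c ∈ C, ∀ z ∈ U, z.2 ∈ c z.1 ↔ z ∈ b

open Finset in
/-- Selections from a list predictor, weighted by `2` to the number of pairs in `U` on their
graph. -/
theorem le_sum_piFinset_two_pow [DecidableEq X] [DecidableEq Y] {ℓ : ℕ} (hℓ : 0 < ℓ)
    (U : Finset (X × Y)) (c : X → Finset Y) (hc : ∀ x, (c x).card = ℓ)
    {b : Finset (X × Y)} (hb : b ⊆ U) (hcb : ∀ z ∈ U, z.2 ∈ c z.1 ↔ z ∈ b) :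
    (ℓ : ℝ) ^ (U.image Prod.fst).card * (2 : ℝ) ^ ((b.card : ℝ) / ℓ) ≤
      ∑ y ∈ Fintype.piFinset fun x : (U.image Prod.fst : Finset X) => c x,
        (2 : ℝ) ^ (univ.filter fun x : (U.image Prod.fst : Finset X) => (x.1, y x) ∈ U).card := by
  set T := U.image Prod.fst with hT
  have hℓ' : (0 : ℝ) < ℓ := by exact_mod_cast hℓ
  have hprod : ∀ y : T → Y, (2 : ℝ) ^ (univ.filter fun x : T => (x.1, y x) ∈ U).card =
      ∏ x : T, if (x.1, y x) ∈ U then (2 : ℝ) else 1 := by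
    intro y
    rw [← prod_filter, prod_const]
  simp_rw [hprod]
  rw [← prod_univ_sum (fun x : T => c x.1) fun (x : T) y => if (x.1, y) ∈ U then (2 : ℝ) else 1]
  let β : X → Finset Y := fun x => (c x).filter fun y => (x, y) ∈ U
  have hsum : ∀ x : T, (∑ y ∈ c x.1, if (x.1, y) ∈ U then (2 : ℝ) else 1) = ℓ + (β x.1).card := by
    intro x
    have : ∀ y, (if (x.1, y) ∈ U then (2 : ℝ) else 1) = 1 + if (x.1, y) ∈ U then 1 else 0 := by
      intro y; split_ifs <;> norm_num
    simp_rw [this, sum_add_distrib, sum_const, hc, β, card_filter]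
    simp
  have hbcard : b.card = ∑ x : T, (β x.1).card := by
    rw [card_eq_sum_card_fiberwise (f := Prod.fst) (t := T) fun z hz =>
      mem_image_of_mem _ (hb hz), ← sum_coe_sort T]
    refine sum_congr rfl fun x _ => ?_
    refine card_bij' (fun z _ => z.2) (fun y _ => (x.1, y)) ?_ ?_ ?_ ?_
    · rintro ⟨x', y⟩ hz
      obtain ⟨h1, h2⟩ := mem_filter.1 hz
      simp only at h2
      subst h2
      exact mem_filter.2 ⟨(hcb _ (hb h1)).2 h1, hb h1⟩
    · intro y hy
      obtain ⟨h1, h2⟩ := mem_filter.1 hy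
      exact mem_filter.2 ⟨(hcb _ h2).1 h1, rfl⟩
    · rintro ⟨x', y⟩ hz
      have := (mem_filter.1 hz).2
      simp only at this
      simp [this]
    · intro y _; rfl
  have hTcard : T.card = (univ : Finset T).card := by simp
  rw [hbcard, hTcard, ← prod_const]
  push_cast
  rw [sum_div, Real.rpow_sum_of_pos (by norm_num), ← prod_mul_distrib]
  refine prod_le_prod (fun _ _ => by positivity) fun x _ => ?_
  rw [hsum]
  have hle : ((β x.1).card : ℝ) ≤ ℓ := by
    have := card_filter_le (c x.1) fun y => (x.1, y) ∈ U
    rw [hc] at this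
    exact_mod_cast this
  have := two_rpow_le_one_add (t := ((β x.1).card : ℝ) / ℓ) (by positivity)
    ((div_le_one hℓ').2 hle)
  calc (ℓ : ℝ) * 2 ^ (((β x.1).card : ℝ) / ℓ) ≤ ℓ * (1 + (β x.1).card / ℓ) := by gcongr
    _ = _ := by field_simp

open Finset in
theorem two_rpow_card_le_of_pairShatters [Fintype Y] {ℓ d : ℕ} (hℓ : 0 < ℓ)
    {C : Set (X → Finset Y)} (hC : ∀ c ∈ C, ∀ x, (c x).card = ℓ) (hd : dsDim ℓ C = (d : ℕ∞))
    {U : Finset (X × Y)} (hU : PairShatters C U) :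
    (2 : ℝ) ^ ((U.card : ℝ) / (2 * ℓ)) ≤ (1 + U.card * Fintype.card Y : ℝ) ^ d := by
  classical
  have hℓ' : (0 : ℝ) < ℓ := by exact_mod_cast hℓ
  set T := U.image Prod.fst with hT
  let F : Finset (T → Y) := (Set.toFinite (patterns C T)).toFinset
  have hFcard : F.card ≤ ℓ ^ T.card * (1 + T.card * Fintype.card Y) ^ d :=
    card_patterns_le hℓ hd T F (by simp [F])
  have hTU : T.card ≤ U.card := card_image_le
  have hU' : ∀ b : Finset (X × Y), ∃ c, b ⊆ U → c ∈ C ∧ ∀ z ∈ U, z.2 ∈ c z.1 ↔ z ∈ b := by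
    intro b
    by_cases hb : b ⊆ U
    · obtain ⟨c, hc⟩ := hU b hb
      exact ⟨c, fun _ => hc⟩
    · exact ⟨fun _ => ∅, fun h => absurd h hb⟩
  choose c hc using hU'
  let Q : (X → Finset Y) → Finset (T → Y) := fun c => Fintype.piFinset fun x : T => c x.1
  let w : (T → Y) → ℕ := fun y => (univ.filter fun x : T => (x.1, y x) ∈ U).card
  have hlower : ∀ b ∈ U.powerset,
      (ℓ : ℝ) ^ T.card * (2 : ℝ) ^ ((b.card : ℝ) / ℓ) ≤ ∑ y ∈ Q (c b), (2 : ℝ) ^ w y := by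
    intro b hb
    have hb := mem_powerset.1 hb
    exact le_sum_piFinset_two_pow hℓ U (c b) (hC _ (hc b hb).1) hb (hc b hb).2
  have hfew : ∀ y : T → Y, (U.powerset.filter fun b => y ∈ Q (c b)).card * 2 ^ w y ≤ 2 ^ U.card := by
    intro y
    let s : Finset (X × Y) := (univ.filter fun x : T => (x.1, y x) ∈ U).image fun x => (x.1, y x)
    have hs : s.card = w y := card_image_of_injective _ fun a b h =>
      Subtype.ext (Prod.ext_iff.1 h).1
    have hsU : s ⊆ U := by
      intro z hz
      obtain ⟨x, hx, rfl⟩ := mem_image.1 hz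
      exact (mem_filter.1 hx).2
    have hsub : (U.powerset.filter fun b => y ∈ Q (c b)) ⊆ Icc s U := by
      intro b hb
      obtain ⟨hb, hy⟩ := mem_filter.1 hb
      have hb := mem_powerset.1 hb
      refine mem_Icc.2 ⟨?_, hb⟩
      intro z hz
      obtain ⟨x, hx, rfl⟩ := mem_image.1 hz
      exact ((hc b hb).2 _ (mem_filter.1 hx).2).1 (Fintype.mem_piFinset.1 hy x)
    have h1 := card_le_card hsub
    rw [card_Icc_finset hsU, hs] at h1
    calc _ ≤ 2 ^ (U.card - w y) * 2 ^ w y := Nat.mul_le_mul_right _ h1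
      _ = 2 ^ U.card := by
        rw [← pow_add, Nat.sub_add_cancel]
        exact hs ▸ card_le_card hsU
  have hupper : ∑ b ∈ U.powerset, ∑ y ∈ Q (c b), (2 : ℝ) ^ w y ≤ F.card * 2 ^ U.card := by
    have hQF : ∀ b ∈ U.powerset, Q (c b) ⊆ F := by
      intro b hb y hy
      simp only [F, Set.Finite.mem_toFinset]
      exact ⟨c b, (hc b (mem_powerset.1 hb)).1, fun j => Fintype.mem_piFinset.1 hy j⟩
    calc ∑ b ∈ U.powerset, ∑ y ∈ Q (c b), (2 : ℝ) ^ w y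
        = ∑ b ∈ U.powerset, ∑ y ∈ F, if y ∈ Q (c b) then (2 : ℝ) ^ w y else 0 := by
          refine sum_congr rfl fun b hb => ?_
          rw [← sum_filter, filter_mem_eq_inter, inter_eq_right.2 (hQF b hb)]
      _ = ∑ y ∈ F, ((U.powerset.filter fun b => y ∈ Q (c b)).card : ℝ) * 2 ^ w y := by
          rw [sum_comm]
          refine sum_congr rfl fun y _ => ?_
          rw [← sum_filter, sum_const, nsmul_eq_mul]
      _ ≤ ∑ y ∈ F, (2 : ℝ) ^ U.card := sum_le_sum fun y _ => by exact_mod_cast hfew y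
      _ = _ := by simp
  set q : ℝ := (2 : ℝ) ^ (1 / (2 * ℓ) : ℝ) with hq
  have hqpos : 0 < q := by positivity
  have hqpow : (2 : ℝ) ^ ((U.card : ℝ) / (2 * ℓ)) = q ^ U.card := by
    rw [hq, ← Real.rpow_natCast, ← Real.rpow_mul (by norm_num)]
    congr 1; ring
  have hq2 : ∀ n : ℕ, (2 : ℝ) ^ ((n : ℝ) / ℓ) = (q ^ 2) ^ n := by
    intro n
    rw [hq, ← pow_mul, ← Real.rpow_natCast, ← Real.rpow_mul (by norm_num)]
    congr 1; push_cast; field_simp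
  have hbin : ∑ b ∈ U.powerset, (ℓ : ℝ) ^ T.card * (2 : ℝ) ^ ((b.card : ℝ) / ℓ) =
      ℓ ^ T.card * (q ^ 2 + 1) ^ U.card := by
    rw [← mul_sum]
    simp_rw [hq2]
    rw [← sum_pow_mul_eq_add_pow]
    simp
  have h1 : (ℓ : ℝ) ^ T.card * (q ^ 2 + 1) ^ U.card ≤ F.card * 2 ^ U.card :=
    hbin ▸ (sum_le_sum hlower).trans hupper
  have h2 : (2 * q) ^ U.card ≤ (q ^ 2 + 1) ^ U.card := by
    gcongr; nlinarith [sq_nonneg (q - 1)]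
  have h3 : (F.card : ℝ) ≤ ℓ ^ T.card * (1 + U.card * Fintype.card Y) ^ d := by
    have hF' : (F.card : ℝ) ≤ ℓ ^ T.card * (1 + T.card * Fintype.card Y) ^ d := by
      exact_mod_cast hFcard
    refine hF'.trans ?_
    gcongr
  have h4 : (ℓ : ℝ) ^ T.card * 2 ^ U.card * q ^ U.card ≤
      ℓ ^ T.card * 2 ^ U.card * (1 + U.card * Fintype.card Y) ^ d := by
    calc (ℓ : ℝ) ^ T.card * 2 ^ U.card * q ^ U.card = ℓ ^ T.card * (2 * q) ^ U.card := by
          rw [mul_pow]; ring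
      _ ≤ ℓ ^ T.card * (q ^ 2 + 1) ^ U.card := by gcongr
      _ ≤ F.card * 2 ^ U.card := h1
      _ ≤ (ℓ ^ T.card * (1 + U.card * Fintype.card Y) ^ d) * 2 ^ U.card := by gcongr
      _ = _ := by ring
  rw [hqpow]
  exact le_of_mul_le_mul_left h4 (by positivity)

/-- The VC dimension of the error sets is at most `24 ℓ d log (ℓ d k)`. -/
theorem card_le_of_pairShatters [Fintype Y] {ℓ d : ℕ}
    {C : Set (X → Finset Y)} (hC : ∀ c ∈ C, ∀ x, (c x).card = ℓ) (hd : dsDim ℓ C = (d : ℕ∞))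
    {U : Finset (X × Y)} (hU : PairShatters C U) :
    (U.card : ℝ) ≤ 24 * (ℓ * d * plog (ℓ * d * Fintype.card Y)) := by
  have hplog : 1 ≤ plog (ℓ * d * Fintype.card Y) := le_max_right _ _
  rcases U.eq_empty_or_nonempty with rfl | ⟨z, hz⟩
  · simp only [Finset.card_empty, Nat.cast_zero]; positivity
  have hℓ : 0 < ℓ := by
    obtain ⟨c, hc, hcU⟩ := hU U subset_rfl
    rw [← hC c hc z.1]
    exact Finset.card_pos.2 ⟨z.2, (hcU z hz).2 hz⟩
  have hk : 0 < Fintype.card Y := Fintype.card_pos_iff.2 ⟨z.2⟩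
  have hv : 0 < U.card := Finset.card_pos.2 ⟨z, hz⟩
  have hmain := two_rpow_card_le_of_pairShatters hℓ hC hd hU
  generalize U.card = v at *
  generalize Fintype.card Y = k at *
  have hℓ' : (1 : ℝ) ≤ ℓ := by exact_mod_cast hℓ
  have hk' : (1 : ℝ) ≤ k := by exact_mod_cast hk
  have hv' : (1 : ℝ) ≤ v := by exact_mod_cast hv
  have hlog := Real.log_le_log (by positivity) hmain
  rw [Real.log_rpow (by norm_num), Real.log_pow] at hlog
  have hlog2 := Real.log_two_gt_d9
  have hd0 : 0 < d := by
    rcases Nat.eq_zero_or_pos d with rfl | h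
    · exfalso
      have : 0 < (v : ℝ) / (2 * ℓ) * Real.log 2 := by positivity
      simp at hlog
      linarith
    · exact h
  have hd' : (1 : ℝ) ≤ d := by exact_mod_cast hd0
  have hlogle : Real.log (1 + v * k) ≤ v / (6 * ℓ * d) + Real.log (12 * (ℓ * d * k)) := by
    have h1 : Real.log (1 + v * k) ≤ Real.log (v / (6 * ℓ * d) * (12 * (ℓ * d * k))) := by
      refine Real.log_le_log (by positivity) ?_
      have : (v : ℝ) / (6 * ℓ * d) * (12 * (ℓ * d * k)) = 2 * (v * k) := by field_simp; norm_num
      rw [this]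
      nlinarith
    rw [Real.log_mul (by positivity) (by positivity)] at h1
    have h2 := Real.log_le_sub_one_of_pos (x := (v : ℝ) / (6 * ℓ * d)) (by positivity)
    linarith
  have hlog12 : Real.log (12 * (ℓ * d * k)) ≤ 4 * plog (ℓ * d * k) := by
    rw [Real.log_mul (by norm_num) (by positivity)]
    have h1 : Real.log 12 ≤ 3 := by
      rw [Real.log_le_iff_le_exp (by norm_num)]
      have := Real.exp_one_gt_d9
      have h3 : Real.exp 3 = Real.exp 1 ^ 3 := by rw [← Real.exp_nat_mul]; norm_num
      rw [h3]
      calc (12 : ℝ) ≤ 2.7 ^ 3 := by norm_num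
        _ ≤ _ := by gcongr; linarith
    have h2 : Real.log (ℓ * d * k) ≤ plog (ℓ * d * k) := le_max_left _ _
    linarith
  have hlow : (v : ℝ) / (3 * ℓ) ≤ v / (2 * ℓ) * Real.log 2 := by
    have : (v : ℝ) / (3 * ℓ) = v / (2 * ℓ) * (2 / 3) := by field_simp
    rw [this]
    gcongr
    linarith
  have hfin : (v : ℝ) / (3 * ℓ) ≤ d * (v / (6 * ℓ * d) + 4 * plog (ℓ * d * k)) :=
    hlow.trans (hlog.trans (by gcongr; linarith))
  have h5 : (d : ℝ) * (v / (6 * ℓ * d) + 4 * plog (ℓ * d * k)) =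
      v / (6 * ℓ) + 4 * d * plog (ℓ * d * k) := by field_simp
  rw [h5] at hfin
  have h6 : (v : ℝ) / (3 * ℓ) = v / (6 * ℓ) + v / (6 * ℓ) := by field_simp; norm_num
  have h7 : (v : ℝ) / (6 * ℓ) ≤ 4 * d * plog (ℓ * d * k) := by linarith
  rw [div_le_iff₀ (by positivity)] at h7
  linarith

section Packing

open Finset

theorem sum_choose_le_exp (s v : ℕ) {t : ℝ} (ht : 0 < t) (ht1 : t ≤ 1) :
    ((∑ i ∈ Iic v, s.choose i : ℕ) : ℝ) ≤ Real.exp (v * Real.log (1 / t) + t * s) := by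
  have h1 : (∑ i ∈ Iic v, (s.choose i : ℝ)) * t ^ v ≤ (1 + t) ^ s := by
    have h2 : (1 + t) ^ s = ∑ i ∈ range (s + 1), t ^ i * s.choose i := by
      rw [add_comm, add_pow]; simp
    rw [h2, sum_mul]
    calc ∑ i ∈ Iic v, (s.choose i : ℝ) * t ^ v
        ≤ ∑ i ∈ Iic v, t ^ i * (s.choose i : ℝ) := by
          refine sum_le_sum fun i hi => ?_
          rw [mul_comm]
          have := pow_le_pow_of_le_one ht.le ht1 (mem_Iic.1 hi)
          gcongr
      _ = ∑ i ∈ (Iic v).filter (· ∈ range (s + 1)), t ^ i * (s.choose i : ℝ) := by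
          rw [sum_filter]
          refine sum_congr rfl fun i _ => ?_
          split_ifs with h
          · rfl
          · rw [Nat.choose_eq_zero_of_lt (by simpa [Nat.lt_succ_iff] using h)]; simp
      _ ≤ _ := sum_le_sum_of_subset_of_nonneg (fun i hi => (mem_filter.1 hi).2)
          fun _ _ _ => by positivity
  have h3 : (1 + t) ^ s ≤ Real.exp (t * s) := by
    rw [mul_comm, Real.exp_nat_mul]
    have := Real.add_one_le_exp t
    gcongr
    linarith
  have h4 : Real.exp (v * Real.log (1 / t)) * t ^ v = 1 := by
    rw [Real.exp_nat_mul, Real.exp_log (by positivity), ← mul_pow, one_div_mul_cancel ht.ne',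
      one_pow]
  push_cast
  rw [Real.exp_add]
  have htv : 0 < t ^ v := by positivity
  refine le_of_mul_le_mul_right ?_ htv
  calc _ ≤ (1 + t) ^ s := h1
    _ ≤ Real.exp (t * s) := h3
    _ = _ := by rw [mul_right_comm, h4, one_mul]

theorem vcDim_image_preimage_le {κ : Type*} [DecidableEq κ] {s : ℕ} (V : Finset (Finset κ))
    (g : Fin s → κ) : (V.image fun A => univ.filter fun i => g i ∈ A).vcDim ≤ V.vcDim := by
  classical
  refine Finset.sup_le fun U hU => ?_
  have hU := mem_shatterer.1 hU
  have hmem : ∀ t ⊆ U, ∃ A ∈ V, ∀ i ∈ U, g i ∈ A ↔ i ∈ t := by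
    intro t ht
    obtain ⟨u, hu, hut⟩ := hU ht
    obtain ⟨A, hA, rfl⟩ := mem_image.1 hu
    exact ⟨A, hA, fun i hi => by simp [← hut, hi]⟩
  have hinj : Set.InjOn g U := by
    intro i hi j hj hij
    obtain ⟨A, -, hA⟩ := hmem {i} (by simpa using hi)
    have := (hA j hj).1 (hij ▸ (hA i hi).2 (mem_singleton_self i))
    exact (mem_singleton.1 this).symm
  rw [← card_image_of_injOn hinj]
  refine Shatters.card_le_vcDim fun t ht => ?_
  obtain ⟨A, hA, hAt⟩ := hmem (U.filter fun i => g i ∈ t) (filter_subset _ _)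
  refine ⟨A, hA, ?_⟩
  ext x
  simp only [mem_inter]
  constructor
  · rintro ⟨hx, hxA⟩
    obtain ⟨i, hi, rfl⟩ := mem_image.1 hx
    exact (mem_filter.1 ((hAt i hi).1 hxA)).2
  · intro hx
    refine ⟨ht hx, ?_⟩
    obtain ⟨i, hi, rfl⟩ := mem_image.1 (ht hx)
    exact (hAt i hi).2 (mem_filter.2 ⟨hi, hx⟩)

/-- A random sample of `s` points separates a well-separated family. -/
theorem exists_separating {κ : Type*} [Fintype κ] [Nonempty κ] [DecidableEq κ]
    (V : Finset (Finset κ)) {ρ : ℝ}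
    (hsep : ∀ A ∈ V, ∀ B ∈ V, A ≠ B → ρ * Fintype.card κ < (symmDiff A B).card)
    (s : ℕ) (hs : (V.card : ℝ) ^ 2 * Real.exp (-(ρ * s)) < 1) :
    ∃ g : Fin s → κ, Set.InjOn (fun A : Finset κ => univ.filter fun i => g i ∈ A) V := by
  classical
  by_contra! hno
  set M := Fintype.card κ with hM
  have hMpos : (0 : ℝ) < M := by exact_mod_cast Fintype.card_pos
  let bad : Finset κ × Finset κ → Finset (Fin s → κ) := fun p =>
    Fintype.piFinset fun _ => (symmDiff p.1 p.2)ᶜ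
  have hcover : (univ : Finset (Fin s → κ)) ⊆
      ((V ×ˢ V).filter fun p => p.1 ≠ p.2).biUnion bad := by
    intro g _
    have := hno g
    simp only [Set.InjOn, not_forall] at this
    obtain ⟨A, hA, B, hB, hAB, hne⟩ := this
    refine mem_biUnion.2 ⟨(A, B), by simp_all, ?_⟩
    refine Fintype.mem_piFinset.2 fun i => ?_
    have := Finset.ext_iff.1 hAB i
    simp only [mem_filter, mem_univ, true_and] at this
    simp only [mem_compl, mem_symmDiff]
    tauto
  have hbad : ∀ p ∈ (V ×ˢ V).filter fun p => p.1 ≠ p.2,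
      ((bad p).card : ℝ) ≤ Real.exp (-(ρ * s)) * M ^ s := by
    intro p hp
    simp only [mem_filter, mem_product] at hp
    have h1 := hsep _ hp.1.1 _ hp.1.2 hp.2
    have h2 : ((symmDiff p.1 p.2)ᶜ.card : ℝ) ≤ Real.exp (-ρ) * M := by
      rw [card_compl, Nat.cast_sub (card_le_univ _)]
      have := Real.add_one_le_exp (-ρ)
      nlinarith
    have h3 : (bad p).card = (symmDiff p.1 p.2)ᶜ.card ^ s := by
      simp [bad, Fintype.card_piFinset]
    rw [h3]
    push_cast
    calc ((symmDiff p.1 p.2)ᶜ.card : ℝ) ^ s ≤ (Real.exp (-ρ) * M) ^ s := by gcongr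
      _ = _ := by
        rw [mul_pow, ← Real.exp_nat_mul]; ring_nf
  have h4 : (M : ℝ) ^ s ≤ (V.card : ℝ) ^ 2 * (Real.exp (-(ρ * s)) * M ^ s) := by
    have h5 := (card_le_card hcover).trans card_biUnion_le
    have h6 : (univ : Finset (Fin s → κ)).card = M ^ s := by simp [hM]
    rw [h6] at h5
    calc (M : ℝ) ^ s ≤ ∑ p ∈ (V ×ˢ V).filter fun p => p.1 ≠ p.2, ((bad p).card : ℝ) := by
          exact_mod_cast h5
      _ ≤ ∑ p ∈ (V ×ˢ V).filter fun p => p.1 ≠ p.2, Real.exp (-(ρ * s)) * M ^ s :=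
          sum_le_sum hbad
      _ = ((V ×ˢ V).filter fun p => p.1 ≠ p.2).card * (Real.exp (-(ρ * s)) * M ^ s) := by simp
      _ ≤ _ := by
          gcongr
          have := card_filter_le (V ×ˢ V) fun p => p.1 ≠ p.2
          rw [card_product, ← sq] at this
          exact_mod_cast this
  have h7 : 0 < (M : ℝ) ^ s := by positivity
  nlinarith

/-- A packing bound for families of bounded VC dimension. -/
theorem card_le_exp_of_separated {κ : Type*} [Fintype κ] [Nonempty κ] [DecidableEq κ]
    (V : Finset (Finset κ)) {ρ : ℝ} (hρ : 0 < ρ) (hρ1 : ρ ≤ 1) {v : ℕ} (hv : V.vcDim ≤ v)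
    (hsep : ∀ A ∈ V, ∀ B ∈ V, A ≠ B → ρ * Fintype.card κ < (symmDiff A B).card) :
    (V.card : ℝ) ≤ Real.exp (1 + 2 * v * Real.log (8 / ρ)) := by
  classical
  have hlog8 : 0 ≤ Real.log (8 / ρ) :=
    Real.log_nonneg (by rw [le_div_iff₀ hρ]; linarith)
  rcases V.eq_empty_or_nonempty with rfl | hne
  · simp; positivity
  have hcpos : (0 : ℝ) < V.card := by exact_mod_cast card_pos.2 hne
  have hc1 : (1 : ℝ) ≤ V.card := by exact_mod_cast card_pos.2 hne
  set L := Real.log V.card with hL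
  have hL0 : 0 ≤ L := Real.log_nonneg hc1
  have hexpL : Real.exp L = V.card := Real.exp_log hcpos
  set s := ⌊2 * L / ρ⌋₊ + 1 with hs
  have hslt : 2 * L / ρ < s := by rw [hs]; push_cast; exact Nat.lt_floor_add_one _
  have hsle : (s : ℝ) ≤ 2 * L / ρ + 1 := by
    rw [hs]; push_cast
    have := Nat.floor_le (a := 2 * L / ρ) (by positivity)
    linarith
  obtain ⟨g, hg⟩ := exists_separating V hsep s (by
    rw [← hexpL, ← Real.exp_nat_mul, ← Real.exp_add, Real.exp_lt_one_iff]
    rw [div_lt_iff₀ hρ] at hslt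
    push_cast
    linarith)
  have h1 : V.card ≤ ∑ i ∈ Iic v, s.choose i := by
    rw [← card_image_of_injOn hg]
    refine (card_le_card_shatterer _).trans (card_shatterer_le_sum_vcDim.trans ?_)
    rw [Fintype.card_fin]
    exact sum_le_sum_of_subset (Iic_subset_Iic.2 ((vcDim_image_preimage_le V g).trans hv))
  have h2 := sum_choose_le_exp s v (t := ρ / 8) (by positivity) (by linarith)
  have h3 : L ≤ v * Real.log (8 / ρ) + ρ / 8 * s := by
    rw [one_div_div] at h2
    rw [← Real.exp_le_exp, hexpL]
    exact le_trans (by exact_mod_cast h1) h2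
  have h4 : ρ / 8 * s ≤ L / 4 + 1 / 8 := by
    calc ρ / 8 * s ≤ ρ / 8 * (2 * L / ρ + 1) := by gcongr
      _ = L / 4 + ρ / 8 := by field_simp; ring
      _ ≤ _ := by linarith
  have h5 : 0 ≤ v * Real.log (8 / ρ) := by positivity
  rw [← hexpL, Real.exp_le_exp]
  linarith

/-- A maximal separated subfamily is a net. -/
theorem exists_net {κ : Type*} [DecidableEq κ] (V : Finset (Finset κ)) {r : ℝ} (hr : 0 ≤ r) :
    ∃ N ⊆ V, (∀ A ∈ N, ∀ B ∈ N, A ≠ B → r < (symmDiff A B).card) ∧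
      ∀ A ∈ V, ∃ B ∈ N, ((symmDiff A B).card : ℝ) ≤ r := by
  classical
  let 𝒮 := V.powerset.filter fun N => ∀ A ∈ N, ∀ B ∈ N, A ≠ B → r < (symmDiff A B).card
  have hne : 𝒮.Nonempty := ⟨∅, by simp [𝒮]⟩
  obtain ⟨N, hN, hmax⟩ := exists_max_image 𝒮 card hne
  simp only [𝒮, mem_filter, mem_powerset] at hN hmax
  refine ⟨N, hN.1, hN.2, fun A hA => ?_⟩
  by_contra! hfar
  have hAN : A ∉ N := fun h => by have := hfar A h; simp at this; linarith
  have := hmax (insert A N) ⟨insert_subset hA hN.1, by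
    intro B hB B' hB' hBB'
    rcases mem_insert.1 hB with rfl | hBN <;> rcases mem_insert.1 hB' with rfl | hBN'
    · exact absurd rfl hBB'
    · exact hfar _ hBN'
    · rw [symmDiff_comm]; exact hfar _ hBN
    · exact hN.2 _ hBN _ hBN' hBB'⟩
  rw [card_insert_of_notMem hAN] at this
  omega

end Packing

section Rademacher

open Finset

/-- The sign of a boolean. -/
def sgn (b : Bool) : ℝ := if b then 1 else -1

theorem sum_exp_sgn_le {ι : Type*} [Fintype ι] [DecidableEq ι] (w : ι → ℝ) :
    ∑ σ : ι → Bool, Real.exp (∑ i, sgn (σ i) * w i) ≤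
      2 ^ Fintype.card ι * Real.exp ((∑ i, w i ^ 2) / 2) := by
  have h1 : ∑ σ : ι → Bool, Real.exp (∑ i, sgn (σ i) * w i) =
      ∏ i, (2 * Real.cosh (w i)) := by
    simp_rw [Real.exp_sum]
    rw [← Fintype.piFinset_univ,
      ← prod_univ_sum (fun _ => univ) fun i b => Real.exp (sgn b * w i)]
    refine prod_congr rfl fun i _ => ?_
    rw [Fintype.sum_bool, Real.cosh_eq]
    simp [sgn]
    ring
  have h2 : (2 : ℝ) ^ Fintype.card ι * Real.exp ((∑ i, w i ^ 2) / 2) =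
      ∏ i, (2 * Real.exp (w i ^ 2 / 2)) := by
    rw [prod_mul_distrib, ← Real.exp_sum, sum_div]
    simp
  rw [h1, h2]
  refine prod_le_prod (fun i _ => by have := Real.cosh_pos (w i); positivity) fun i _ => ?_
  have := Real.cosh_le_exp_half_sq (w i)
  gcongr

theorem card_lt_sum_sgn_le {ι : Type*} [Fintype ι] [DecidableEq ι] (w : ι → ℝ) {t R : ℝ}
    (ht : 0 < t) (hR : 0 < R) (hw : ∑ i, w i ^ 2 ≤ R) :
    ((univ.filter fun σ : ι → Bool => t < ∑ i, sgn (σ i) * w i).card : ℝ) ≤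
      2 ^ Fintype.card ι * Real.exp (-(t ^ 2 / (2 * R))) := by
  set a := t / R with ha
  have h1 := sum_exp_sgn_le fun i => a * w i
  have h2 : ∀ σ : ι → Bool, ∑ i, sgn (σ i) * (a * w i) = a * ∑ i, sgn (σ i) * w i := by
    intro σ; rw [mul_sum]; exact sum_congr rfl fun _ _ => by ring
  have h3 : ∑ i, (a * w i) ^ 2 = a ^ 2 * ∑ i, w i ^ 2 := by
    rw [mul_sum]; exact sum_congr rfl fun _ _ => by ring
  simp_rw [h2, h3] at h1
  have h4 : ((univ.filter fun σ : ι → Bool => t < ∑ i, sgn (σ i) * w i).card : ℝ) *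
      Real.exp (a * t) ≤ 2 ^ Fintype.card ι * Real.exp (a ^ 2 * R / 2) := by
    calc _ = ∑ σ ∈ univ.filter fun σ : ι → Bool => t < ∑ i, sgn (σ i) * w i,
          Real.exp (a * t) := by simp
      _ ≤ ∑ σ ∈ univ.filter fun σ : ι → Bool => t < ∑ i, sgn (σ i) * w i,
          Real.exp (a * ∑ i, sgn (σ i) * w i) := by
          refine sum_le_sum fun σ hσ => ?_
          have := (mem_filter.1 hσ).2
          gcongr
      _ ≤ ∑ σ : ι → Bool, Real.exp (a * ∑ i, sgn (σ i) * w i) :=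
          sum_le_sum_of_subset_of_nonneg (subset_univ _) fun _ _ _ => by positivity
      _ ≤ _ := h1
      _ ≤ _ := by gcongr
  have h5 : Real.exp (-(t ^ 2 / (2 * R))) = Real.exp (a ^ 2 * R / 2) * Real.exp (-(a * t)) := by
    rw [← Real.exp_add]
    congr 1
    rw [ha]; field_simp; ring
  rw [h5, ← mul_assoc, Real.exp_neg, ← div_eq_mul_inv, le_div_iff₀ (Real.exp_pos _)]
  exact h4

/-- Hoeffding's inequality for Rademacher sums, in counting form. -/
theorem card_lt_abs_sum_sgn_le {ι : Type*} [Fintype ι] [DecidableEq ι] (w : ι → ℝ) {t R : ℝ}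
    (ht : 0 < t) (hR : 0 < R) (hw : ∑ i, w i ^ 2 ≤ R) :
    ((univ.filter fun σ : ι → Bool => t < |∑ i, sgn (σ i) * w i|).card : ℝ) ≤
      2 ^ Fintype.card ι * (2 * Real.exp (-(t ^ 2 / (2 * R)))) := by
  have h1 := card_lt_sum_sgn_le w ht hR hw
  have h2 := card_lt_sum_sgn_le (fun i => -w i) ht hR (by simpa using hw)
  have h3 : (univ.filter fun σ : ι → Bool => t < |∑ i, sgn (σ i) * w i|) ⊆
      (univ.filter fun σ : ι → Bool => t < ∑ i, sgn (σ i) * w i) ∪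
      (univ.filter fun σ : ι → Bool => t < ∑ i, sgn (σ i) * -w i) := by
    intro σ hσ
    simp only [mem_filter, mem_univ, true_and, mem_union, lt_abs] at hσ ⊢
    simpa [mul_neg, sum_neg_distrib] using hσ
  have h4 := (card_le_card h3).trans (card_union_le _ _)
  have h5 : ((univ.filter fun σ : ι → Bool => t < |∑ i, sgn (σ i) * w i|).card : ℝ) ≤
      (univ.filter fun σ : ι → Bool => t < ∑ i, sgn (σ i) * w i).card +
      (univ.filter fun σ : ι → Bool => t < ∑ i, sgn (σ i) * -w i).card := by exact_mod_cast h4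
  linarith

end Rademacher

section Chaining

open Finset

/-- The difference of the indicators of `A` at the two copies of `i`. -/
def pairDiff {ι : Type*} [DecidableEq ι] (A : Finset (ι ⊕ ι)) (i : ι) : ℝ :=
  (if Sum.inl i ∈ A then 1 else 0) - (if Sum.inr i ∈ A then 1 else 0)

theorem sum_sq_pairDiff_sub_le {ι : Type*} [Fintype ι] [DecidableEq ι] (A B : Finset (ι ⊕ ι)) :
    ∑ i, (pairDiff A i - pairDiff B i) ^ 2 ≤ 2 * (symmDiff A B).card := by
  have h1 : ((symmDiff A B).card : ℝ) = ∑ x : ι ⊕ ι, if x ∈ symmDiff A B then (1 : ℝ) else 0 := by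
    simp
  rw [h1, Fintype.sum_sum_type, ← sum_add_distrib, mul_sum]
  refine sum_le_sum fun i _ => ?_
  simp only [pairDiff, mem_symmDiff]
  by_cases h1 : Sum.inl i ∈ A <;> by_cases h2 : Sum.inr i ∈ A <;>
    by_cases h3 : Sum.inl i ∈ B <;> by_cases h4 : Sum.inr i ∈ B <;> simp [h1, h2, h3, h4] <;>
    norm_num

theorem log_eight_mul_four_pow (j : ℕ) :
    Real.log (8 / (1 / 4 : ℝ) ^ j) = (3 + 2 * j) * Real.log 2 := by
  have : 8 / (1 / 4 : ℝ) ^ j = 2 ^ (3 + 2 * j) := by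
    rw [pow_add, pow_mul, one_div, inv_pow, div_inv_eq_mul]; norm_num
  rw [this, Real.log_pow]
  push_cast
  ring

/-- Nets at all the scales `4 ^ (-j)`, starting from the empty set. -/
theorem exists_nets {κ : Type*} [Fintype κ] [Nonempty κ] [DecidableEq κ]
    (V : Finset (Finset κ)) {v : ℕ} (hv : V.vcDim ≤ v) :
    ∃ N : ℕ → Finset (Finset κ), N 0 = {∅} ∧ (∀ j, N (j + 1) ⊆ V) ∧
      (∀ j, ((N j).card : ℝ) ≤ Real.exp (1 + 2 * v * ((3 + 2 * j) * Real.log 2))) ∧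
      ∀ j, ∀ A ∈ V, ∃ B ∈ N j,
        ((symmDiff A B).card : ℝ) ≤ (1 / 4 : ℝ) ^ j * Fintype.card κ := by
  have hnet : ∀ j : ℕ, ∃ N ⊆ V,
      ((N.card : ℝ) ≤ Real.exp (1 + 2 * v * ((3 + 2 * j) * Real.log 2))) ∧
      ∀ A ∈ V, ∃ B ∈ N, ((symmDiff A B).card : ℝ) ≤ (1 / 4 : ℝ) ^ j * Fintype.card κ := by
    intro j
    obtain ⟨N, hN, hsep, hcov⟩ := exists_net V
      (r := (1 / 4 : ℝ) ^ j * Fintype.card κ) (by positivity)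
    refine ⟨N, hN, ?_, hcov⟩
    rw [← log_eight_mul_four_pow]
    exact card_le_exp_of_separated N (by positivity) (pow_le_one₀ (by norm_num) (by norm_num))
      ((vcDim_mono hN).trans hv) hsep
  choose N hN hcard hcov using hnet
  refine ⟨fun j => if j = 0 then {∅} else N j, by simp, fun j => by simpa using hN (j + 1),
    fun j => ?_, fun j A hA => ?_⟩
  · by_cases hj : j = 0
    · subst hj
      have : 0 ≤ Real.log 2 := Real.log_nonneg (by norm_num)
      simp; positivity
    · simpa [hj] using hcard j
  · by_cases hj : j = 0
    · subst hj
      refine ⟨∅, by simp, ?_⟩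
      simpa using card_le_univ (symmDiff A ∅)
    · simpa [hj] using hcov j A hA

theorem chaining_exponent_le {v L K : ℝ} (hv : 0 ≤ v) (hL : 1 ≤ L) (hK : 20 * (v + L) ≤ K)
    (j : ℕ) :
    (1 + 2 * v * ((3 + 2 * j) * Real.log 2)) + (1 + 2 * v * ((3 + 2 * (j + 1)) * Real.log 2)) +
      1 + (j + 2) + L ≤ K * (16 / 9 : ℝ) ^ j := by
  have h1 : 1 + (j : ℝ) * (7 / 9) ≤ (16 / 9 : ℝ) ^ j := by
    have := one_add_mul_le_pow (a := (7 / 9 : ℝ)) (by norm_num) j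
    norm_num at this ⊢
    exact this
  have hj : (0 : ℝ) ≤ j := by positivity
  have h2 : 20 * (v + L) * (1 + (j : ℝ) * (7 / 9)) ≤ K * (16 / 9 : ℝ) ^ j := by
    gcongr
    linarith
  have hlog : Real.log 2 ≤ 7 / 10 := by have := Real.log_two_lt_d9; linarith
  have h3 : 2 * v * (8 + 4 * j) * Real.log 2 ≤ 2 * v * (8 + 4 * j) * (7 / 10) := by gcongr
  have hvj : 0 ≤ v * j := by positivity
  have hLj : (j : ℝ) ≤ L * j := by nlinarith
  nlinarith

/-- Chaining: for most choices of signs the symmetrized deviations of a family of bounded VC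
dimension are uniformly small. -/
theorem card_signs_deviation_le {ι : Type*} [Fintype ι] [Nonempty ι] [DecidableEq ι]
    (V : Finset (Finset (ι ⊕ ι))) {v : ℕ} (hv : V.vcDim ≤ v) {ε δ : ℝ} (hε : 0 < ε) (hδ : 0 < δ)
    (hn : 5760 * (v + plog (1 / δ)) ≤ Fintype.card ι * ε ^ 2) :
    ((univ.filter fun σ : ι → Bool => ∃ A ∈ V,
      Fintype.card ι * ε / 2 < |∑ i, sgn (σ i) * pairDiff A i|).card : ℝ) ≤
      2 ^ Fintype.card ι * (δ / 2) := by
  classical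
  set n := Fintype.card ι with hndef
  have hn0 : (0 : ℝ) < n := by exact_mod_cast Fintype.card_pos
  have hκ : (Fintype.card (ι ⊕ ι) : ℝ) = 2 * n := by
    rw [Fintype.card_sum]; push_cast; ring
  obtain ⟨N, hN0, hNV, hNcard, hNcov⟩ := exists_nets V hv
  simp_rw [hκ] at hNcov
  let Z : (ι → Bool) → Finset (ι ⊕ ι) → ℝ := fun σ A => ∑ i, sgn (σ i) * pairDiff A i
  let t : ℕ → ℝ := fun j => n * ε / 6 * (2 / 3) ^ j
  let bad : ℕ → Finset (ι → Bool) := fun j => univ.filter fun σ => ∃ p ∈ N j ×ˢ N (j + 1),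
    ((symmDiff p.2 p.1).card : ℝ) ≤ (1 / 4 : ℝ) ^ j * (2 * n) ∧ t j < |Z σ p.2 - Z σ p.1|
  have hbad : ∀ j, ((bad j).card : ℝ) ≤ 2 ^ n * (δ / 2 * (1 / 2) ^ (j + 1)) := by
    intro j
    have htj : 0 < t j := by positivity
    have hsub : bad j ⊆ ((N j ×ˢ N (j + 1)).filter fun p =>
        ((symmDiff p.2 p.1).card : ℝ) ≤ (1 / 4 : ℝ) ^ j * (2 * n)).biUnion fun p =>
          univ.filter fun σ => t j < |∑ i, sgn (σ i) * (pairDiff p.2 i - pairDiff p.1 i)| := by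
      intro σ hσ
      obtain ⟨p, hp, hp1, hp2⟩ := (mem_filter.1 hσ).2
      refine mem_biUnion.2 ⟨p, mem_filter.2 ⟨hp, hp1⟩, mem_filter.2 ⟨mem_univ _, ?_⟩⟩
      simp only [mul_sub, sum_sub_distrib]
      exact hp2
    have hone : ∀ p ∈ (N j ×ˢ N (j + 1)).filter fun p =>
        ((symmDiff p.2 p.1).card : ℝ) ≤ (1 / 4 : ℝ) ^ j * (2 * n),
        ((univ.filter fun σ : ι → Bool =>
          t j < |∑ i, sgn (σ i) * (pairDiff p.2 i - pairDiff p.1 i)|).card : ℝ) ≤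
        2 ^ n * (2 * Real.exp (-(n * ε ^ 2 / 288 * (16 / 9) ^ j))) := by
      intro p hp
      have h1 := (mem_filter.1 hp).2
      have h2 := card_lt_abs_sum_sgn_le (fun i => pairDiff p.2 i - pairDiff p.1 i) htj
        (R := 4 * n * (1 / 4) ^ j) (by positivity)
        ((sum_sq_pairDiff_sub_le p.2 p.1).trans (by linarith))
      have h3 : t j ^ 2 / (2 * (4 * n * (1 / 4) ^ j)) = n * ε ^ 2 / 288 * (16 / 9) ^ j := by
        have h4 : (16 / 9 : ℝ) ^ j = ((2 / 3) ^ j) ^ 2 / (1 / 4) ^ j := by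
          rw [← pow_mul, mul_comm j 2, pow_mul, ← div_pow]; norm_num
        rw [h4]
        simp only [t]
        field_simp
        ring
      rwa [h3] at h2
    have h1 : ((bad j).card : ℝ) ≤ ((N j).card * (N (j + 1)).card) *
        (2 ^ n * (2 * Real.exp (-(n * ε ^ 2 / 288 * (16 / 9) ^ j)))) := by
      have h5 := (card_le_card hsub).trans card_biUnion_le
      calc ((bad j).card : ℝ) ≤ _ := Nat.cast_le.2 h5
        _ ≤ _ := by
          push_cast
          exact sum_le_sum hone
        _ ≤ _ := by
          rw [sum_const, nsmul_eq_mul]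
          gcongr
          have := card_filter_le (N j ×ˢ N (j + 1)) fun p =>
            ((symmDiff p.2 p.1).card : ℝ) ≤ (1 / 4 : ℝ) ^ j * (2 * n)
          rw [card_product] at this
          exact_mod_cast this
    have hL : 1 ≤ plog (1 / δ) := le_max_right _ _
    have h2 := chaining_exponent_le (v := v) (L := plog (1 / δ)) (K := n * ε ^ 2 / 288)
      (by positivity) hL (by linarith) j
    have h3 : (2 : ℝ) ≤ Real.exp 1 := by have := Real.exp_one_gt_d9; linarith
    have h4 : Real.exp (-((j : ℝ) + 2) - plog (1 / δ)) ≤ δ / 2 * (1 / 2) ^ (j + 1) := by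
      have h5 : Real.exp (-((j : ℝ) + 2)) ≤ (1 / 2) ^ (j + 2) := by
        have : -((j : ℝ) + 2) = ((j + 2 : ℕ) : ℝ) * (-1) := by push_cast; ring
        rw [this, Real.exp_nat_mul, Real.exp_neg]
        have : (Real.exp 1)⁻¹ ≤ 1 / 2 := by
          rw [one_div]; exact inv_anti₀ (by norm_num) h3
        gcongr
      have h6 : Real.exp (-plog (1 / δ)) ≤ δ := by
        have : Real.log (1 / δ) ≤ plog (1 / δ) := le_max_left _ _
        rw [one_div, Real.log_inv] at this
        calc Real.exp (-plog (1 / δ)) ≤ Real.exp (Real.log δ) := by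
              rw [Real.exp_le_exp]; rw [one_div]; linarith
          _ = δ := Real.exp_log hδ
      rw [sub_eq_add_neg, Real.exp_add]
      calc _ ≤ (1 / 2 : ℝ) ^ (j + 2) * δ := by gcongr
        _ = _ := by ring
    refine h1.trans ?_
    have h7 : ((N j).card : ℝ) * (N (j + 1)).card *
        (2 * Real.exp (-(n * ε ^ 2 / 288 * (16 / 9) ^ j))) ≤ δ / 2 * (1 / 2) ^ (j + 1) := by
      have hb := hNcard (j + 1)
      push_cast at hb
      calc _ ≤ Real.exp (1 + 2 * v * ((3 + 2 * j) * Real.log 2)) *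
            Real.exp (1 + 2 * v * ((3 + 2 * (j + 1)) * Real.log 2)) *
            (Real.exp 1 * Real.exp (-(n * ε ^ 2 / 288 * (16 / 9) ^ j))) := by
            gcongr
            exact hNcard j
        _ ≤ Real.exp (-((j : ℝ) + 2) - plog (1 / δ)) := by
            rw [← Real.exp_add, ← Real.exp_add, ← Real.exp_add, Real.exp_le_exp]
            linarith
        _ ≤ _ := h4
    calc _ = 2 ^ n * (((N j).card : ℝ) * (N (j + 1)).card *
        (2 * Real.exp (-(n * ε ^ 2 / 288 * (16 / 9) ^ j)))) := by ring
      _ ≤ _ := by gcongr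
  obtain ⟨J, hJ⟩ : ∃ J : ℕ, (1 / 4 : ℝ) ^ J * (2 * n) < 1 := by
    obtain ⟨J, hJ⟩ := exists_pow_lt_of_lt_one (x := 1 / (2 * (n : ℝ))) (y := 1 / 4)
      (by positivity) (by norm_num)
    exact ⟨J, by rwa [lt_div_iff₀ (by positivity)] at hJ⟩
  have hgood : ∀ σ, (∀ j < J, σ ∉ bad j) → ∀ j ≤ J, ∀ A ∈ N j,
      |Z σ A| ≤ ∑ i ∈ range j, t i := by
    intro σ hσ j
    induction j with
    | zero =>
      intro _ A hA
      rw [hN0, mem_singleton] at hA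
      simp [Z, hA, pairDiff]
    | succ j ih =>
      intro hj A hA
      obtain ⟨B, hB, hAB⟩ := hNcov j A (hNV j hA)
      have h1 := ih (by omega) B hB
      have h2 : |Z σ A - Z σ B| ≤ t j := by
        by_contra! h
        exact hσ j (by omega) (mem_filter.2 ⟨mem_univ _, (B, A),
          mem_product.2 ⟨hB, hA⟩, hAB, h⟩)
      rw [sum_range_succ]
      have h3 := abs_sub_abs_le_abs_sub (Z σ A) (Z σ B)
      linarith
  have hsubset : (univ.filter fun σ : ι → Bool => ∃ A ∈ V, n * ε / 2 < |Z σ A|) ⊆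
      (range J).biUnion bad := by
    intro σ hσ
    obtain ⟨A, hA, hlt⟩ := (mem_filter.1 hσ).2
    by_contra hnot
    simp only [mem_biUnion, mem_range, not_exists, not_and] at hnot
    have hAJ : A ∈ N J := by
      obtain ⟨B, hB, hAB⟩ := hNcov J A hA
      have h1 : (symmDiff A B).card < 1 := by exact_mod_cast hAB.trans_lt hJ
      have h2 : symmDiff A B = ∅ := card_eq_zero.1 (by omega)
      rw [← bot_eq_empty, symmDiff_eq_bot] at h2
      rwa [h2]
    have h1 := hgood σ hnot J le_rfl A hAJ
    have h2 : ∑ i ∈ range J, t i ≤ n * ε / 2 := by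
      simp only [t]
      rw [← mul_sum, geom_sum_eq (by norm_num)]
      have : (0 : ℝ) ≤ (2 / 3) ^ J := by positivity
      have h3 : 0 < n * ε := by positivity
      have h4 : ((2 / 3 : ℝ) ^ J - 1) / (2 / 3 - 1) ≤ 3 := by
        rw [div_le_iff_of_neg (by norm_num)]; linarith
      calc n * ε / 6 * (((2 / 3 : ℝ) ^ J - 1) / (2 / 3 - 1)) ≤ n * ε / 6 * 3 := by gcongr
        _ = _ := by ring
    linarith
  calc _ ≤ (((range J).biUnion bad).card : ℝ) := Nat.cast_le.2 (card_le_card hsubset)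
    _ ≤ ∑ j ∈ range J, ((bad j).card : ℝ) := by exact_mod_cast card_biUnion_le
    _ ≤ ∑ j ∈ range J, 2 ^ n * (δ / 2 * (1 / 2) ^ (j + 1)) := sum_le_sum fun j _ => hbad j
    _ = 2 ^ n * (δ / 2) * ((1 / 2) * ∑ j ∈ range J, (1 / 2 : ℝ) ^ j) := by
      rw [mul_sum, mul_sum]; exact sum_congr rfl fun j _ => by ring
    _ ≤ 2 ^ n * (δ / 2) * 1 := by
      gcongr
      rw [geom_sum_eq (by norm_num)]
      have : (0 : ℝ) ≤ (1 / 2) ^ J := by positivity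
      have h1 : ((1 / 2 : ℝ) ^ J - 1) / (1 / 2 - 1) ≤ 2 := by
        rw [div_le_iff_of_neg (by norm_num)]; linarith
      linarith
    _ = _ := by ring

end Chaining

theorem loss_nonneg (c : X → Finset Y) (z : X × Y) : 0 ≤ loss c z :=
  Set.indicator_nonneg (fun _ _ => zero_le_one) z

theorem loss_le_one (c : X → Finset Y) (z : X × Y) : loss c z ≤ 1 :=
  Set.indicator_le' (fun _ _ => le_rfl) (fun _ _ => zero_le_one) z

/-- The VC dimension of the error sets on a family of points. -/
theorem vcDim_errorSets_le {C : Set (X → Finset Y)} {κ : Type*} [DecidableEq κ] (z : κ → X × Y)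
    {v : ℕ} (hv : ∀ U : Finset (X × Y), PairShatters C U → U.card ≤ v) (V : Finset (Finset κ))
    (hV : ∀ A ∈ V, ∃ c ∈ C, ∀ j, j ∈ A ↔ (z j).2 ∉ c (z j).1) : V.vcDim ≤ v := by
  classical
  refine Finset.sup_le fun U hU => ?_
  have hU := Finset.mem_shatterer.1 hU
  have hmem : ∀ s ⊆ U, ∃ c ∈ C, ∀ j ∈ U, (z j).2 ∈ c (z j).1 ↔ j ∈ s := by
    intro s hs
    obtain ⟨A, hA, hAs⟩ := hU (Finset.sdiff_subset (s := U) (t := s))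
    obtain ⟨c, hc, hcA⟩ := hV A hA
    refine ⟨c, hc, fun j hj => ?_⟩
    have h1 := hcA j
    have h2 := Finset.ext_iff.1 hAs j
    simp only [Finset.mem_inter, Finset.mem_sdiff, hj, true_and] at h2
    tauto
  have hinj : Set.InjOn z U := by
    intro i hi j hj hij
    obtain ⟨c, -, hc⟩ := hmem {i} (by simpa using hi)
    have h1 := (hc i hi).2 (Finset.mem_singleton_self i)
    rw [hij] at h1
    exact (Finset.mem_singleton.1 ((hc j hj).1 h1)).symm
  rw [← Finset.card_image_of_injOn hinj]
  refine hv _ fun b hb => ?_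
  obtain ⟨c, hc, hcb⟩ := hmem (U.filter fun j => z j ∈ b) (Finset.filter_subset _ _)
  refine ⟨c, hc, fun w hw => ?_⟩
  obtain ⟨j, hj, rfl⟩ := Finset.mem_image.1 hw
  rw [hcb j hj]
  simp [hj]

/-- The event that some predictor has very different losses on the two halves of a double sample. -/
def doubleEvent (C : Set (X → Finset Y)) (n : ℕ) (t : ℝ) : Set (Fin n ⊕ Fin n → X × Y) :=
  {z | ∃ c ∈ C, t < |∑ i, (loss c (z (Sum.inl i)) - loss c (z (Sum.inr i)))|}

/-- The permutation of the double sample that exchanges the two copies of `i` if `σ i` is false. -/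
def swapPerm {n : ℕ} (σ : Fin n → Bool) : Equiv.Perm (Fin n ⊕ Fin n) :=
  Function.Involutive.toPerm
    (Sum.elim (fun i => if σ i then Sum.inl i else Sum.inr i)
      fun i => if σ i then Sum.inr i else Sum.inl i)
    (by rintro (i | i) <;> cases h : σ i <;> simp [h])

theorem mem_doubleEvent_swapPerm {C : Set (X → Finset Y)} {n : ℕ} {t : ℝ} (σ : Fin n → Bool)
    (z : Fin n ⊕ Fin n → X × Y) :
    (fun j => z (swapPerm σ j)) ∈ doubleEvent C n t ↔
      ∃ c ∈ C, t < |∑ i, sgn (σ i) * (loss c (z (Sum.inl i)) - loss c (z (Sum.inr i)))| := by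
  have : ∀ (c : X → Finset Y) (i : Fin n),
      loss c (z (swapPerm σ (Sum.inl i))) - loss c (z (swapPerm σ (Sum.inr i))) =
      sgn (σ i) * (loss c (z (Sum.inl i)) - loss c (z (Sum.inr i))) := by
    intro c i
    cases h : σ i <;> simp [swapPerm, Function.Involutive.toPerm, sgn, h]
  simp only [doubleEvent, Set.mem_ofPred_eq, this]

variable [MeasurableSpace X] [MeasurableSpace Y]

section

variable {D : Measure (X × Y)} {C : Set (X → Finset Y)}

theorem aemeasurable_loss (hM : IsMeasurableClass C D) {c : X → Finset Y} (hc : c ∈ C) :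
    AEMeasurable (loss c) D :=
  aemeasurable_const.indicator₀ (hM.error c hc)

theorem integral_loss (hM : IsMeasurableClass C D) {c : X → Finset Y} (hc : c ∈ C) :
    ∫ z, loss c z ∂D = popLoss D c := by
  simp only [loss, popLoss]
  rw [integral_indicator₀ (hM.error c hc)]
  simp

/-- Chebyshev's inequality for the empirical loss of a single predictor. -/
theorem half_le_measure_deviation_lt [IsProbabilityMeasure D] (hM : IsMeasurableClass C D)
    {c : X → Finset Y} (hc : c ∈ C) {n : ℕ} (hn : 0 < n) {ε : ℝ} (hε : 0 < ε)
    (hnε : 2 ≤ n * ε ^ 2) :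
    (2⁻¹ : ENNReal) ≤ (Measure.pi fun _ : Fin n => D)
      {S | |∑ i, loss c (S i) - n * popLoss D c| < n * ε / 2} := by
  have hn' : (0 : ℝ) < n := by exact_mod_cast hn
  have hL2 : MemLp (loss c) 2 D :=
    MemLp.of_bound (aemeasurable_loss hM hc).aestronglyMeasurable 1 (Filter.Eventually.of_forall
      fun z => by
        rw [Real.norm_eq_abs, abs_of_nonneg (loss_nonneg c z)]; exact loss_le_one c z)
  have hL2i : ∀ i : Fin n, MemLp (fun S : Fin n → X × Y => loss c (S i)) 2
      (Measure.pi fun _ : Fin n => D) := fun i =>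
    hL2.comp_measurePreserving (measurePreserving_eval (fun _ : Fin n => D) i)
  set W : (Fin n → X × Y) → ℝ := ∑ i, fun S => loss c (S i) with hW
  have hWapp : ∀ S, W S = ∑ i, loss c (S i) := fun S => by simp [hW]
  have hWL2 : MemLp W 2 (Measure.pi fun _ : Fin n => D) := memLp_finsetSum' _ fun i _ => hL2i i
  have hmean : ∫ S, W S ∂(Measure.pi fun _ : Fin n => D) = n * popLoss D c := by
    simp_rw [hWapp]
    rw [integral_finsetSum _ fun i _ => (hL2i i).integrable (by norm_num)]
    have : ∀ i : Fin n, ∫ S, loss c (S i) ∂(Measure.pi fun _ : Fin n => D) = popLoss D c := by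
      intro i
      rw [integral_comp_eval (μ := fun _ : Fin n => D) (f := loss c)
        (aemeasurable_loss hM hc).aestronglyMeasurable, integral_loss hM hc]
    simp [this]
  have hvar : ProbabilityTheory.variance W (Measure.pi fun _ : Fin n => D) ≤ n / 4 := by
    rw [hW, ProbabilityTheory.variance_sum_pi (μ := fun _ : Fin n => D)
      (X := fun _ => loss c) fun _ => hL2]
    have h1 := ProbabilityTheory.variance_le_sq_of_bounded (μ := D) (a := 0) (b := 1)
      (Filter.Eventually.of_forall fun z => ⟨loss_nonneg c z, loss_le_one c z⟩)
      (aemeasurable_loss hM hc)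
    rw [Finset.sum_const, Finset.card_univ, Fintype.card_fin, nsmul_eq_mul]
    nlinarith
  have hcheb := ProbabilityTheory.meas_ge_le_variance_div_sq hWL2
    (c := n * ε / 2) (by positivity)
  rw [hmean] at hcheb
  have hle : (Measure.pi fun _ : Fin n => D) {S | n * ε / 2 ≤ |W S - n * popLoss D c|} ≤ 2⁻¹ := by
    refine hcheb.trans ?_
    rw [← ENNReal.ofReal_ofNat 2, ← ENNReal.ofReal_inv_of_pos (by norm_num)]
    refine ENNReal.ofReal_le_ofReal ?_
    rw [div_le_iff₀ (by positivity)]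
    nlinarith
  have hcompl : {S | |∑ i, loss c (S i) - n * popLoss D c| < n * ε / 2} =
      {S | n * ε / 2 ≤ |W S - n * popLoss D c|}ᶜ := by
    ext S; simp [hWapp]
  rw [hcompl]
  have h1 : (1 : ENNReal) ≤ (Measure.pi fun _ : Fin n => D)
        {S | n * ε / 2 ≤ |W S - n * popLoss D c|} +
      (Measure.pi fun _ : Fin n => D) {S | n * ε / 2 ≤ |W S - n * popLoss D c|}ᶜ := by
    rw [← measure_univ (μ := Measure.pi fun _ : Fin n => D), ← Set.union_compl_self
      {S | n * ε / 2 ≤ |W S - n * popLoss D c|}]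
    exact measure_union_le _ _
  have h2 : (2⁻¹ : ENNReal) = 1 - 2⁻¹ := by rw [ENNReal.one_sub_inv_two]
  rw [h2, tsub_le_iff_left]
  exact h1.trans (by gcongr)

theorem measurePreserving_comp_equiv {ι κ Ω : Type*} [Fintype ι] [Fintype κ] [MeasurableSpace Ω]
    (P : Measure Ω) [SigmaFinite P] (f : ι ≃ κ) :
    MeasurePreserving (fun (z : κ → Ω) (i : ι) => z (f i)) (Measure.pi fun _ => P)
      (Measure.pi fun _ => P) := by
  have h := measurePreserving_piCongrLeft (fun _ : ι => P) f.symm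
  convert h using 1
  funext z i
  have := MeasurableEquiv.piCongrLeft_apply_apply (β := fun _ : ι => Ω) f.symm z (f i)
  simpa using this.symm

theorem nullMeasurableSet_doubleEvent [IsProbabilityMeasure D] (hM : IsMeasurableClass C D)
    (n : ℕ) (t : ℝ) :
    NullMeasurableSet (doubleEvent C n t) (Measure.pi fun _ : Fin n ⊕ Fin n => D) := by
  rcases C.eq_empty_or_nonempty with rfl | hne
  · simp [doubleEvent]
  have : Nonempty C := hne.to_subtype
  let e : Fin (n + n) → ℝ := fun j => Sum.elim (fun _ => 1) (fun _ => -1) (finSumFinEquiv.symm j)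
  have hmeas := (hM.sup (n + n) e).comp_quasiMeasurePreserving
    (measurePreserving_comp_equiv D (finSumFinEquiv (m := n) (n := n)).symm).quasiMeasurePreserving
  have hset := nullMeasurableSet_lt (aemeasurable_const (b := t)) hmeas
  convert hset using 1
  ext z
  have hsum : ∀ c : X → Finset Y, ∑ i, e i * loss c (z (finSumFinEquiv.symm i)) =
      ∑ i, (loss c (z (Sum.inl i)) - loss c (z (Sum.inr i))) := by
    intro c
    simp only [e]
    rw [Equiv.sum_comp finSumFinEquiv.symm fun s =>
      Sum.elim (fun _ => (1 : ℝ)) (fun _ => -1) s * loss c (z s), Fintype.sum_sum_type,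
      Finset.sum_sub_distrib]
    simp [sub_eq_add_neg]
  simp only [doubleEvent, Set.mem_ofPred_eq, Function.comp_apply, hsum]
  have hbdd : BddAbove (Set.range fun c : C =>
      |∑ i, (loss c.1 (z (Sum.inl i)) - loss c.1 (z (Sum.inr i)))|) := by
    refine ⟨n, ?_⟩
    rintro _ ⟨c, rfl⟩
    refine (Finset.abs_sum_le_sum_abs _ _).trans ?_
    calc _ ≤ ∑ _i : Fin n, (1 : ℝ) := Finset.sum_le_sum fun i _ => by
          rw [abs_le]
          constructor <;> linarith [loss_nonneg c.1 (z (Sum.inl i)), loss_le_one c.1 (z (Sum.inl i)),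
            loss_nonneg c.1 (z (Sum.inr i)), loss_le_one c.1 (z (Sum.inr i))]
      _ = n := by simp
  rw [lt_ciSup_iff hbdd]
  simp

/-- Symmetrization by a ghost sample. -/
theorem measure_deviation_le_two_mul [IsProbabilityMeasure D] (hM : IsMeasurableClass C D)
    {n : ℕ} (hn : 0 < n) {ε : ℝ} (hε : 0 < ε) (hnε : 2 ≤ n * ε ^ 2) :
    (Measure.pi fun _ : Fin n => D) {S | ∃ c ∈ C, ε < |popLoss D c - empLoss c S|} ≤
      2 * (Measure.pi fun _ : Fin n ⊕ Fin n => D) (doubleEvent C n (n * ε / 2)) := by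
  have hn' : (0 : ℝ) < n := by exact_mod_cast hn
  set ν := Measure.pi fun _ : Fin n => D with hν
  have hmp := measurePreserving_sumPiEquivProdPi_symm
    (X := fun _ : Fin n ⊕ Fin n => X × Y) fun _ => D
  set Ψ := (MeasurableEquiv.sumPiEquivProdPi fun _ : Fin n ⊕ Fin n => X × Y).symm with hΨ
  set E := doubleEvent C n (n * ε / 2) with hE
  have hμE : (Measure.pi fun _ : Fin n ⊕ Fin n => D) E = (ν.prod ν) (Ψ ⁻¹' E) := by
    rw [← hmp.measure_preimage_equiv E]
  set M := toMeasurable (ν.prod ν) (Ψ ⁻¹' E) with hMdef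
  have hMmeas : MeasurableSet M := measurableSet_toMeasurable _ _
  have hsub : {S | ∃ c ∈ C, ε < |popLoss D c - empLoss c S|} ⊆
      {S | 2⁻¹ ≤ ν (Prod.mk S ⁻¹' M)} := by
    rintro S ⟨c, hc, hS⟩
    refine (half_le_measure_deviation_lt hM hc hn hε hnε).trans (measure_mono ?_)
    intro S' hS'
    refine subset_toMeasurable _ _ (?_ : Ψ (S, S') ∈ E)
    refine ⟨c, hc, ?_⟩
    have h1 : ∀ i, Ψ (S, S') (Sum.inl i) = S i := fun i => rfl
    have h2 : ∀ i, Ψ (S, S') (Sum.inr i) = S' i := fun i => rfl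
    simp only [h1, h2, Finset.sum_sub_distrib]
    have h3 : popLoss D c - empLoss c S = (n * popLoss D c - ∑ i, loss c (S i)) / n := by
      simp only [empLoss]; field_simp
    rw [h3, abs_div, abs_of_pos hn', lt_div_iff₀ hn'] at hS
    have hS' : |∑ i, loss c (S' i) - n * popLoss D c| < n * ε / 2 := hS'
    have h4 := abs_add_le (∑ i, loss c (S i) - ∑ i, loss c (S' i))
      (∑ i, loss c (S' i) - n * popLoss D c)
    rw [sub_add_sub_cancel, abs_sub_comm] at h4
    linarith
  have hmarkov := mul_meas_ge_le_lintegral (μ := ν)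
    (measurable_measure_prodMk_left (ν := ν) hMmeas) 2⁻¹
  rw [← Measure.prod_apply hMmeas, measure_toMeasurable, ← hμE] at hmarkov
  calc _ ≤ ν {S | 2⁻¹ ≤ ν (Prod.mk S ⁻¹' M)} := measure_mono hsub
    _ = 2 * (2⁻¹ * ν {S | 2⁻¹ ≤ ν (Prod.mk S ⁻¹' M)}) := by
      rw [← mul_assoc, ENNReal.mul_inv_cancel (by norm_num) (by norm_num), one_mul]
    _ ≤ _ := by gcongr

open Classical in
/-- Symmetrization by random signs: it is enough to bound, for each double sample, the number of
choices of signs with a large deviation. -/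
theorem measure_doubleEvent_le [IsProbabilityMeasure D] (hM : IsMeasurableClass C D)
    {n : ℕ} {t η : ℝ}
    (h : ∀ z : Fin n ⊕ Fin n → X × Y,
      ((Finset.univ.filter fun σ : Fin n → Bool => ∃ c ∈ C,
        t < |∑ i, sgn (σ i) * (loss c (z (Sum.inl i)) - loss c (z (Sum.inr i)))|).card : ℝ) ≤
        2 ^ n * η) :
    (Measure.pi fun _ : Fin n ⊕ Fin n => D) (doubleEvent C n t) ≤ ENNReal.ofReal η := by
  set μ := Measure.pi fun _ : Fin n ⊕ Fin n => D with hμ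
  set E := doubleEvent C n t with hE
  have hEm : NullMeasurableSet E μ := nullMeasurableSet_doubleEvent hM n t
  let sw : (Fin n → Bool) → (Fin n ⊕ Fin n → X × Y) → Fin n ⊕ Fin n → X × Y :=
    fun σ z j => z (swapPerm σ j)
  have hmp : ∀ σ, MeasurePreserving (sw σ) μ μ := fun σ => measurePreserving_comp_equiv D _
  have hEσ : ∀ σ, NullMeasurableSet (sw σ ⁻¹' E) μ := fun σ =>
    hEm.preimage (hmp σ).quasiMeasurePreserving
  have h1 : (2 : ENNReal) ^ n * μ E = ∑ σ : Fin n → Bool, μ (sw σ ⁻¹' E) := by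
    simp_rw [fun σ => (hmp σ).measure_preimage hEm]
    simp
  have h2 : ∑ σ : Fin n → Bool, μ (sw σ ⁻¹' E) =
      ∫⁻ z, ∑ σ : Fin n → Bool, (sw σ ⁻¹' E).indicator 1 z ∂μ := by
    have hind : ∀ σ, AEMeasurable
        ((sw σ ⁻¹' E).indicator (1 : (Fin n ⊕ Fin n → X × Y) → ENNReal)) μ := fun σ =>
      aemeasurable_one.indicator₀ (hEσ σ)
    rw [lintegral_finsetSum' _ fun σ _ => hind σ]
    exact Finset.sum_congr rfl fun σ _ => (lintegral_indicator_one₀ (hEσ σ)).symm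
  have h3 : ∫⁻ z, ∑ σ : Fin n → Bool, (sw σ ⁻¹' E).indicator 1 z ∂μ ≤
      ∫⁻ _, ENNReal.ofReal (2 ^ n * η) ∂μ := by
    refine lintegral_mono fun z => ?_
    have h4 : ∑ σ : Fin n → Bool, (sw σ ⁻¹' E).indicator 1 z =
        ((Finset.univ.filter fun σ : Fin n → Bool => ∃ c ∈ C,
        t < |∑ i, sgn (σ i) * (loss c (z (Sum.inl i)) - loss c (z (Sum.inr i)))|).card :
          ENNReal) := by
      rw [Finset.card_filter]
      push_cast
      refine Finset.sum_congr rfl fun σ _ => ?_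
      simp only [Set.indicator_apply, Set.mem_preimage, sw, hE, mem_doubleEvent_swapPerm,
        Pi.one_apply]
    rw [h4, ← ENNReal.ofReal_natCast]
    exact ENNReal.ofReal_le_ofReal (h z)
  rw [← h2, ← h1, lintegral_const, measure_univ, mul_one, ENNReal.ofReal_mul (by positivity),
    ENNReal.ofReal_pow (by norm_num), ENNReal.ofReal_ofNat] at h3
  exact (ENNReal.mul_le_mul_iff_right (by simp) (by simp)).1 h3

end

section

variable {ℓ d : ℕ} {C : Set (X → Finset Y)}

/-- Uniform convergence at every sample size above the chaining bound, for a class whose error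
sets have VC dimension at most `v`. -/
theorem uniformAt_of_pairShatters_card_le {v : ℕ}
    (hv : ∀ U : Finset (X × Y), PairShatters C U → U.card ≤ v) {ε δ : ℝ} (hε : 0 < ε) (hδ : 0 < δ)
    {n : ℕ} (hn : 0 < n) (hnε : 5760 * (v + plog (1 / δ)) ≤ n * ε ^ 2) : UniformAt C ε δ n := by
  classical
  intro D _ hM
  have : Nonempty (Fin n) := ⟨⟨0, hn⟩⟩
  have hL : 1 ≤ plog (1 / δ) := le_max_right _ _
  have hv0 : (0 : ℝ) ≤ v := by positivity
  refine (measure_deviation_le_two_mul hM hn hε (by linarith)).trans ?_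
  have hdouble : (Measure.pi fun _ : Fin n ⊕ Fin n => D) (doubleEvent C n (n * ε / 2)) ≤
      ENNReal.ofReal (δ / 2) := by
    refine measure_doubleEvent_le hM fun z => ?_
    let err : (X → Finset Y) → Finset (Fin n ⊕ Fin n) := fun c =>
      Finset.univ.filter fun j => (z j).2 ∉ c (z j).1
    let V : Finset (Finset (Fin n ⊕ Fin n)) := (Set.toFinite (err '' C)).toFinset
    have hV : V.vcDim ≤ v := vcDim_errorSets_le z hv V fun A hA => by
      simp only [V, Set.Finite.mem_toFinset] at hA
      obtain ⟨c, hc, rfl⟩ := hA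
      exact ⟨c, hc, fun j => by simp [err]⟩
    have h1 := card_signs_deviation_le V hV hε hδ (by simpa using hnε)
    rw [Fintype.card_fin] at h1
    refine le_trans (Nat.cast_le.2 (Finset.card_le_card fun σ hσ => ?_)) h1
    obtain ⟨c, hc, hlt⟩ := (Finset.mem_filter.1 hσ).2
    refine Finset.mem_filter.2 ⟨Finset.mem_univ _, err c, ?_, ?_⟩
    · simp only [V, Set.Finite.mem_toFinset]
      exact ⟨c, hc, rfl⟩
    · have h2 : ∀ i, loss c (z (Sum.inl i)) - loss c (z (Sum.inr i)) = pairDiff (err c) i := by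
        intro i
        simp [pairDiff, err, loss, Set.indicator_apply]
      simpa only [h2] using hlt
  calc _ ≤ 2 * ENNReal.ofReal (δ / 2) := by gcongr
    _ = ENNReal.ofReal δ := by
      rw [← ENNReal.ofReal_ofNat 2, ← ENNReal.ofReal_mul (by norm_num)]
      congr 1; ring

/-- A sample size at which uniform convergence holds. -/
theorem exists_uniformAt [Fintype Y] (hC : ∀ c ∈ C, ∀ x, (c x).card = ℓ)
    (hd : dsDim ℓ C = (d : ℕ∞)) {ε δ : ℝ} (hε : ε ∈ Set.Ioo (0 : ℝ) 1)
    (hδ : δ ∈ Set.Ioo (0 : ℝ) 1) :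
    ∃ n : ℕ, 0 < n ∧ UniformAt C ε δ n ∧
      (n : ℝ) ≤ 150000 * ((ℓ : ℝ) * d * plog ((ℓ : ℝ) * d * Fintype.card Y) + plog (1 / δ)) /
        ε ^ 2 := by
  have hL : 1 ≤ plog (1 / δ) := le_max_right _ _
  have hε0 := hε.1
  have hε2 : 0 < ε ^ 2 := by positivity
  have hε1 : ε ^ 2 ≤ 1 := pow_le_one₀ hε0.le hε.2.le
  set W := (ℓ : ℝ) * d * plog ((ℓ : ℝ) * d * Fintype.card Y) with hW
  have hW0 : 0 ≤ W := by
    have : 1 ≤ plog ((ℓ : ℝ) * d * Fintype.card Y) := le_max_right _ _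
    positivity
  set v := ⌊24 * W⌋₊ with hvdef
  have hvW : (v : ℝ) ≤ 24 * W := Nat.floor_le (by positivity)
  set n := ⌈5760 * (v + plog (1 / δ)) / ε ^ 2⌉₊ with hn
  have hnpos : 0 < n := Nat.ceil_pos.2 (by positivity)
  have hnge : 5760 * (v + plog (1 / δ)) / ε ^ 2 ≤ n := Nat.le_ceil _
  refine ⟨n, hnpos, uniformAt_of_pairShatters_card_le (v := v)
    (fun U hU => Nat.le_floor (card_le_of_pairShatters hC hd hU)) hε0 hδ.1 hnpos
    ((div_le_iff₀ hε2).1 hnge), ?_⟩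
  have hnlt : (n : ℝ) < 5760 * (v + plog (1 / δ)) / ε ^ 2 + 1 := Nat.ceil_lt_add_one (by positivity)
  refine hnlt.le.trans ?_
  rw [div_add_one hε2.ne']
  gcongr
  linarith

end

end ListUC

end

open ListUC in
theorem theorem3 :
    ∃ A : ℝ, 0 < A ∧
      ∀ (X Y : Type*) [MeasurableSpace X] [MeasurableSpace Y] [Fintype Y]
        (ℓ d k : ℕ) (C : Set (X → Finset Y)),
        (∀ c ∈ C, ∀ x, (c x).card = ℓ) →
        dsDim ℓ C = (d : ℕ∞) →
        Fintype.card Y = k →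
        SatisfiesUC C ∧
          ∀ ε ∈ Set.Ioo (0 : ℝ) 1, ∀ δ ∈ Set.Ioo (0 : ℝ) 1,
            (ucSampleComplexity C ε δ : ℝ) ≤
              A * ((ℓ : ℝ) * d * plog ((ℓ : ℝ) * d * k) + plog (1 / δ)) / ε ^ 2 := by
  refine ⟨150000, by norm_num, ?_⟩
  intro X Y _ _ _ ℓ d k C hC hd hk
  subst hk
  refine ⟨⟨fun ε δ => ucSampleComplexity C ε δ, fun ε hε δ hδ => ?_⟩, fun ε hε δ hδ => ?_⟩
  · obtain ⟨n, hn, hun, -⟩ := exists_uniformAt hC hd hε hδ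
    exact Nat.sInf_mem (s := {n : ℕ | 0 < n ∧ UniformAt C ε δ n}) ⟨n, hn, hun⟩
  · obtain ⟨n, hn, hun, hle⟩ := exists_uniformAt hC hd hε hδ
    exact le_trans (Nat.cast_le.2 (Nat.sInf_le ⟨hn, hun⟩)) hle
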